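/- Let $M,K\ge 0$ be integers, put $n=M+K$, and let $S,N$ be independent random vectors in $\mathbb R^{n}$ with finite second moments, where the law of $N$ has a Lebesgue density. Let $X=S+N$, assume $\operatorname{Cov}(N)=\mu I$ with $\mu>0$, and let $\lambda_1\ge\dots\ge\lambda_{n}$ be the eigenvalues of $\operatorname{Cov}(X)$. For an invertible real $n\times n$ matrix $T$ put $Y^T=T^{\mathsf T}X$ and $\tilde N^T=T^{\mathsf T}N$, and for a vector $Z\in\mathbb R^{n}$ let $Z_M$ and $Z_c$ denote its first $M$ and its last $K$ coordinates. The relevant information loss is $$L_S(X\to Y)=\sup_{q}\big(I(q(S);X)-I(q(S);Y)\big),$$ with the supremum over all finite measurable partitions $q$ of the sample space of $S$; informations and entropies are in nats. Let $Z_G$ be the Gaussian vector with the same first and second moments as $Z$, let $h(\cdot\,|\,\cdot)$ be conditional differential entropy, and let $J(Z_c|Z_M)=D(P_{Z_c|Z_M}\,\|\,P_{Z_{c,G}|Z_{M,G}}\,|\,P_{Z_M})\in[0,\infty]$ be the conditional Kullback–Leibler divergence (equal to $h(Z_{c,G}|Z_{M,G})-h(Z_c|Z_M)$ when the entropies are finite).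 Call $$B(T)=h(Y^T_{c,G}\,|\,Y^T_{M,G})-h(\tilde N^T_{c,G}\,|\,\tilde N^T_{M,G})$$ the Gaussian upper bound of $T$. Let $W$ be an orthogonal matrix with $W^{\mathsf T}\operatorname{Cov}(X)W=\operatorname{diag}(\lambda_1,\dots,\lambda_{n})$ (so $X\mapsto Y^W_M$ is the PCA), and assume that $N$ is more Gaussian than $Y^W$ in the sense that $J(\tilde N^W_c|\tilde N^W_M)<\infty$ and $J(\tilde N^W_c|\tilde N^W_M)\le J(Y^W_c|Y^W_M)$. Then: 1. $L_S(X\to Y^W_M)\le B(W)$. 2. $B(W)=\frac12\ln\prod_{i=M+1}^{n}\frac{\lambda_i}{\mu}$. 3. $B(W)\le B(T)$ for every invertible $T$ (in particular for every orthogonal $T$). Moreover, $L_S(X\to Y^T_M)\le B(T)$ for every invertible $T$ with $J(\tilde N^T_c|\tilde N^T_M)<\infty$ and $J(\tilde N^T_c|\tilde N^T_M)\le J(Y^T_c|Y^T_M)$. -/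

import Mathlib

open MeasureTheory ProbabilityTheory InformationTheory
open scoped ENNReal Matrix

noncomputable section

namespace RelevantLoss

/-- Mutual information (in nats) `I(U;V) = D(P_{U,V} ‖ P_U ⊗ P_V)`. -/
def mutualInfo {Ω α β : Type*} [MeasurableSpace Ω] [MeasurableSpace α] [MeasurableSpace β]
    (P : Measure Ω) (U : Ω → α) (V : Ω → β) : ℝ≥0∞ :=
  klDiv (P.map (fun ω => (U ω, V ω))) ((P.map U).prod (P.map V))

/-- The information loss from `X` to its function `Y` that is relevant w.r.t. `S`: the supremum of
`I(Ŝ;X) - I(Ŝ;Y)` over all quantizations `Ŝ = q(S)`, where `q` ranges over the finite measurable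
partitions of the sample space of `S`. As `Ŝ` takes finitely many values, both informations are
finite; by data processing the difference is nonnegative. -/
def relevantLoss {Ω σ α β : Type*} [MeasurableSpace Ω] [MeasurableSpace σ] [MeasurableSpace α]
    [MeasurableSpace β] (P : Measure Ω) (S : Ω → σ) (X : Ω → α) (Y : Ω → β) : ℝ≥0∞ :=
  ⨆ (k : ℕ) (q : σ → Fin k) (_ : Measurable q),
    (mutualInfo P (fun ω => q (S ω)) X - mutualInfo P (fun ω => q (S ω)) Y)

/-- Covariance matrix of a law on Euclidean space. -/
def covMatrix {n : ℕ} (Q : Measure (EuclideanSpace ℝ (Fin n))) : Matrix (Fin n) (Fin n) ℝ :=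
  Matrix.of fun i j => cov[fun x => x i, fun x => x j; Q]

/-- The Gaussian law with the same mean and the same covariance matrix as `Q`. -/
def gaussianCounterpart {n : ℕ} (Q : Measure (EuclideanSpace ℝ (Fin n))) :
    Measure (EuclideanSpace ℝ (Fin n)) :=
  multivariateGaussian (∫ x, x ∂Q) (covMatrix Q)

/-- The linear map `x ↦ Tᵀ x`. -/
def transform {n : ℕ} (T : Matrix (Fin n) (Fin n) ℝ) (x : EuclideanSpace ℝ (Fin n)) :
    EuclideanSpace ℝ (Fin n) :=
  WithLp.toLp 2 (Tᵀ *ᵥ (fun i => x i))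

/-- The first `M` coordinates. -/
def firstPart (M K : ℕ) (z : EuclideanSpace ℝ (Fin (M + K))) : EuclideanSpace ℝ (Fin M) :=
  WithLp.toLp 2 (fun i => z (Fin.castAdd K i))

/-- The last `K` coordinates. -/
def lastPart (M K : ℕ) (z : EuclideanSpace ℝ (Fin (M + K))) : EuclideanSpace ℝ (Fin K) :=
  WithLp.toLp 2 (fun i => z (Fin.natAdd M i))

/-- If `Q` is the law of `Z`, this is the joint law of `(Z_M, Z_c)`, the first `M` and the last `K`
coordinates of `Z`. -/
def splitLaw (M K : ℕ) (Q : Measure (EuclideanSpace ℝ (Fin (M + K)))) :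
    Measure (EuclideanSpace ℝ (Fin M) × EuclideanSpace ℝ (Fin K)) :=
  Q.map (fun z => (firstPart M K z, lastPart M K z))

/-- Conditional differential entropy (in nats) `h(V | U) = - E[ln (f(U,V) / f(U))]`, where `(U, V)`
has law `p` with Lebesgue density `f(u,v)` and `U` has density `f(u)`. -/
def condDiffEntropy {α β : Type*} [MeasureSpace α] [MeasureSpace β] (p : Measure (α × β)) : ℝ :=
  - ∫ z, Real.log ((p.rnDeriv volume z).toReal / (p.fst.rnDeriv volume z.1).toReal) ∂p

instance {n : ℕ} (Q : Measure (EuclideanSpace ℝ (Fin n))) :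
    IsProbabilityMeasure (gaussianCounterpart Q) := by
  unfold gaussianCounterpart; infer_instance

instance (M K : ℕ) (Q : Measure (EuclideanSpace ℝ (Fin (M + K)))) [IsFiniteMeasure Q] :
    IsFiniteMeasure (splitLaw M K Q) := by
  unfold splitLaw; infer_instance

/-- The conditional divergence `J(Z_c | Z_M) = D(P_{Z_c|Z_M} ‖ P_{Z_{c,G}|Z_{M,G}} | P_{Z_M})` of a
vector `Z` with law `Q` from the Gaussian vector `Z_G = (Z_{M,G}, Z_{c,G})` with the same joint
first and second moments: the divergence between the joint law of `(Z_M, Z_c)` and the law that has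
the first marginal of `Z_M` and the conditional law of `Z_{c,G}` given `Z_{M,G}`. -/
def condDivergence (M K : ℕ) (Q : Measure (EuclideanSpace ℝ (Fin (M + K)))) : ℝ≥0∞ :=
  klDiv (splitLaw M K Q)
    ((splitLaw M K Q).fst ⊗ₘ (splitLaw M K (gaussianCounterpart Q)).condKernel)

/-- `h(Z_{c,G} | Z_{M,G})` for the Gaussian counterpart `Z_G` of a vector `Z` with law `Q`. -/
def gaussianCondEntropy (M K : ℕ) (Q : Measure (EuclideanSpace ℝ (Fin (M + K)))) : ℝ :=
  condDiffEntropy (splitLaw M K (gaussianCounterpart Q))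

/-- The Gaussian upper bound `h(Y_{c,G} | Y_{M,G}) - h(Ñ_{c,G} | Ñ_{M,G})` on the relevant
information loss, for `Y = Tᵀ X` and `Ñ = Tᵀ N`. -/
def gaussianBound {Ω : Type*} [MeasurableSpace Ω] (M K : ℕ) (P : Measure Ω)
    (X N : Ω → EuclideanSpace ℝ (Fin (M + K))) (T : Matrix (Fin (M + K)) (Fin (M + K)) ℝ) : ℝ :=
  gaussianCondEntropy M K (P.map (fun ω => transform T (X ω)))
    - gaussianCondEntropy M K (P.map (fun ω => transform T (N ω)))

/-- `Ñ = Tᵀ N` is more Gaussian than `Y = Tᵀ X`: `J(Ñ_c | Ñ_M) ≤ J(Y_c | Y_M)`, where the divergence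
on the left is finite. -/
def MoreGaussian {Ω : Type*} [MeasurableSpace Ω] (M K : ℕ) (P : Measure Ω)
    (X N : Ω → EuclideanSpace ℝ (Fin (M + K))) (T : Matrix (Fin (M + K)) (Fin (M + K)) ℝ) : Prop :=
  condDivergence M K (P.map (fun ω => transform T (N ω))) ≠ ∞ ∧
    condDivergence M K (P.map (fun ω => transform T (N ω)))
      ≤ condDivergence M K (P.map (fun ω => transform T (X ω)))

end RelevantLoss

end

noncomputable section

namespace RelevantLoss

/-! Write V = Y_M, W = Y_c, U = q(S), and let κ be the conditional law of Y_{c,G} given Y_{M,G}.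
Since T is invertible, X and (V, W) carry the same information. Expanding the divergence of P_{UVW}
from the law with U independent of V and W | V distributed as κ in two ways gives J(Y_c|Y_M) +
I(U;V,W) = I(U;V) + D(P_{UVW} ‖ P_{UV} κ). By data processing the last term is at most D(P_{SVW} ‖
P_{SV} κ), uniformly in q. This chain rule is `klDiv_add_klDiv_eq`; the resulting criterion is
`relevantLoss_le_ofReal`.

Given S = s, the vector Y is Ñ shifted by Tᵀs. Translation invariance of Lebesgue measure therefore
bounds D(P_{SVW} ‖ P_{SV} κ) by J(Ñ_c|Ñ_M) + B(T) (`klDiv_map_shiftMap_le`). Only expectations of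
logarithms of Gaussian conditional densities enter; these are quadratic, so they depend on first and
second moments alone and equal minus the Gaussian conditional entropies. Thus no differential
entropy of a non-Gaussian law has to exist. The hypothesis J(Ñ_c|Ñ_M) ≤ J(Y_c|Y_M) then leaves L_S ≤
B(T).

For the remaining claims, let C = Cov(X) and let A be the first M columns of T. The Gaussian
entropies give 2 B(T) = ln det C − K ln μ + ln det(AᵀA) − ln det(AᵀCA). For T = W this is explicit.
Optimality of W is the inequality det(AᵀCA) ≤ λ₁⋯λ_M det(AᵀA): in an eigenbasis, Cauchy–Binet writes
both determinants as sums of squared minors, weighted on the left by products of M distinct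
eigenvalues (`det_transpose_mul_diagonal_mul_le`). -/

/-- Pushing forward a measure whose density factors through the map. -/
lemma map_withDensity_comp {α β : Type*} [MeasurableSpace α] [MeasurableSpace β] (μ : Measure α)
    {g : α → β} (hg : Measurable g) {f : β → ℝ≥0∞} (hf : Measurable f) :
    (μ.withDensity (fun x => f (g x))).map g = (μ.map g).withDensity f := by
  ext s hs
  rw [Measure.map_apply hg hs, withDensity_apply _ (hg hs), withDensity_apply _ hs,
    setLIntegral_map hs hf hg]

/-! ### Densities of Gaussian laws -/

/-- The logarithm of the density of the Gaussian law with mean `m` and covariance matrix `S`. -/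
def gaussianLogDensity {n : ℕ} (m : EuclideanSpace ℝ (Fin n)) (S : Matrix (Fin n) (Fin n) ℝ)
    (x : EuclideanSpace ℝ (Fin n)) : ℝ :=
  -(n / 2 * Real.log (2 * Real.pi)) - Real.log S.det / 2
    - (fun i => x i - m i) ⬝ᵥ S⁻¹ *ᵥ (fun i => x i - m i) / 2

lemma continuous_gaussianLogDensity {n : ℕ} (m : EuclideanSpace ℝ (Fin n))
    (S : Matrix (Fin n) (Fin n) ℝ) : Continuous (gaussianLogDensity m S) := by
  unfold gaussianLogDensity
  simp only [dotProduct, Matrix.mulVec]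
  fun_prop

@[fun_prop]
lemma measurable_gaussianLogDensity {n : ℕ} (m : EuclideanSpace ℝ (Fin n))
    (S : Matrix (Fin n) (Fin n) ℝ) : Measurable (gaussianLogDensity m S) :=
  (continuous_gaussianLogDensity m S).measurable

/-- This is the Gaussian Fourier integral with parameter 1/2. The normalizing constant is kept
inside the exponential so that every density has the form exp of a real function, whose logarithm is
immediate. -/
lemma integral_exp_neg_norm_sq_mul_exp_inner {n : ℕ} (t : EuclideanSpace ℝ (Fin n)) :
    ∫ x : EuclideanSpace ℝ (Fin n),
      Real.exp (-(n / 2 * Real.log (2 * Real.pi)) - ‖x‖ ^ 2 / 2) •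
        Complex.exp (inner ℝ x t * Complex.I) = Complex.exp (-‖t‖ ^ 2 / 2) := by
  have h := GaussianFourier.integral_cexp_neg_mul_sq_norm_add (V := EuclideanSpace ℝ (Fin n))
    (b := (1 / 2 : ℂ)) (by norm_num) Complex.I t
  have h1 : (fun x : EuclideanSpace ℝ (Fin n) =>
      Real.exp (-(n / 2 * Real.log (2 * Real.pi)) - ‖x‖ ^ 2 / 2) •
        Complex.exp (inner ℝ x t * Complex.I)) = fun x =>
      Complex.exp (-(n / 2 * Real.log (2 * Real.pi))) *
      Complex.exp (-(1 / 2 : ℂ) * ‖x‖ ^ 2 + Complex.I * inner ℝ t x) := by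
    ext x
    rw [Complex.real_smul, Complex.ofReal_exp, ← Complex.exp_add, ← Complex.exp_add,
      real_inner_comm]
    congr 1
    push_cast
    ring
  rw [h1, integral_const_mul, h]
  have h2 : ((Real.pi : ℂ) / (1 / 2)) ^ ((Module.finrank ℝ (EuclideanSpace ℝ (Fin n)) : ℂ) / 2)
      = Complex.exp (n / 2 * Real.log (2 * Real.pi)) := by
    have hpi : (Real.pi : ℂ) / (1 / 2) = ((2 * Real.pi : ℝ) : ℂ) := by push_cast; ring
    rw [hpi, Complex.cpow_def_of_ne_zero (by exact_mod_cast Real.two_pi_pos.ne'),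
      ← Complex.ofReal_log Real.two_pi_pos.le]
    congr 1
    simp
    ring
  rw [h2, ← mul_assoc, ← Complex.exp_add, ← Complex.exp_add]
  congr 1
  rw [Complex.I_sq]
  ring

lemma integrable_exp_neg_norm_sq (n : ℕ) :
    Integrable (fun x : EuclideanSpace ℝ (Fin n) =>
      Real.exp (-(n / 2 * Real.log (2 * Real.pi)) - ‖x‖ ^ 2 / 2)) := by
  have h := (GaussianFourier.integrable_cexp_neg_mul_sq_norm_add
    (V := EuclideanSpace ℝ (Fin n)) (b := (1 / 2 : ℂ)) (by norm_num) 0 0).norm.const_mul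
    (Real.exp (-(n / 2 * Real.log (2 * Real.pi))))
  refine h.congr (ae_of_all _ fun x => ?_)
  simp only [Complex.norm_exp]
  rw [← Real.exp_add]
  congr 1
  rw [zero_mul, add_zero, ← Complex.ofReal_pow]
  have : -(1 / 2 : ℂ) * ((‖x‖ ^ 2 : ℝ) : ℂ) = ((-(1 / 2) * ‖x‖ ^ 2 : ℝ) : ℂ) := by push_cast; ring
  rw [this, Complex.ofReal_re]
  ring

/-- The density of the standard Gaussian law. -/
lemma stdGaussian_eq_withDensity (n : ℕ) :
    stdGaussian (EuclideanSpace ℝ (Fin n)) = volume.withDensity (fun x =>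
      ENNReal.ofReal (Real.exp (-(n / 2 * Real.log (2 * Real.pi)) - ‖x‖ ^ 2 / 2))) := by
  have : IsFiniteMeasure (volume.withDensity (fun x : EuclideanSpace ℝ (Fin n) =>
      ENNReal.ofReal (Real.exp (-(n / 2 * Real.log (2 * Real.pi)) - ‖x‖ ^ 2 / 2)))) :=
    isFiniteMeasure_withDensity_ofReal (integrable_exp_neg_norm_sq n).2
  apply Measure.ext_of_charFun
  ext t
  rw [charFun_stdGaussian, charFun_apply,
    integral_withDensity_eq_integral_toReal_smul (by fun_prop) (by simp)]
  simp_rw [ENNReal.toReal_ofReal (Real.exp_pos _).le]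
  exact (integral_exp_neg_norm_sq_mul_exp_inner t).symm

/-- Whitening: a symmetric square root A of S satisfies A S⁻¹ A = 1. -/
lemma dotProduct_inv_mulVec_sqrt {n : ℕ} {S A : Matrix (Fin n) (Fin n) ℝ} (hS : S.PosDef)
    (hA : Aᵀ = A) (hAS : A * A = S) (x : Fin n → ℝ) :
    (A *ᵥ x) ⬝ᵥ S⁻¹ *ᵥ (A *ᵥ x) = x ⬝ᵥ x := by
  have hdet : IsUnit A.det := by
    have : IsUnit (A * A).det := by rw [hAS]; exact hS.det_pos.ne'.isUnit
    rw [Matrix.det_mul] at this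
    exact isUnit_of_mul_isUnit_left this
  rw [← hAS, Matrix.mul_inv_rev, Matrix.mulVec_mulVec, Matrix.mul_assoc,
    Matrix.nonsing_inv_mul _ hdet, Matrix.mul_one, Matrix.dotProduct_mulVec]
  rw [← Matrix.mulVec_transpose, Matrix.mulVec_mulVec,
    Matrix.transpose_nonsing_inv, hA, Matrix.nonsing_inv_mul _ hdet, Matrix.one_mulVec]

open scoped MatrixOrder in
/-- The density of a nondegenerate Gaussian law. -/
lemma multivariateGaussian_eq_withDensity {n : ℕ} (m : EuclideanSpace ℝ (Fin n))
    {S : Matrix (Fin n) (Fin n) ℝ} (hS : S.PosDef) :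
    multivariateGaussian m S
      = volume.withDensity (fun x => ENNReal.ofReal (Real.exp (gaussianLogDensity m S x))) := by
  set A := CFC.sqrt S with hA
  have hAS : A * A = S := CFC.sqrt_mul_sqrt_self _ hS.posSemidef.nonneg
  have hAT : Aᵀ = A := by
    have h := (CFC.sqrt_nonneg S).isSelfAdjoint.star_eq
    rwa [Matrix.star_eq_conjTranspose, Matrix.conjTranspose_eq_transpose_of_trivial] at h
  have hdet2 : A.det * A.det = S.det := by rw [← Matrix.det_mul, hAS]
  have hdet : A.det ≠ 0 := by
    intro h
    rw [h, zero_mul] at hdet2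
    exact hS.det_pos.ne hdet2
  set g : EuclideanSpace ℝ (Fin n) → EuclideanSpace ℝ (Fin n) :=
    fun x => m + Matrix.toEuclideanCLM (𝕜 := ℝ) A x with hg
  have hgm : Measurable g := by fun_prop
  have hlog : ∀ x, gaussianLogDensity m S (g x)
      = -(n / 2 * Real.log (2 * Real.pi)) - Real.log |A.det| - ‖x‖ ^ 2 / 2 := by
    intro x
    have h1 : (fun i => g x i - m i) = A *ᵥ (fun i => x i) := by
      ext i
      simp [hg, Matrix.ofLp_toEuclideanCLM]
    have h2 : (fun i => x i) ⬝ᵥ (fun i => x i) = ‖x‖ ^ 2 := by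
      rw [EuclideanSpace.real_norm_sq_eq]
      simp [dotProduct, sq]
    have h3 : Real.log S.det = 2 * Real.log |A.det| := by
      rw [← hdet2, Real.log_mul hdet hdet, Real.log_abs]; ring
    rw [gaussianLogDensity, h1, dotProduct_inv_mulVec_sqrt hS hAT hAS, h2, h3]
    ring
  have hvol : (volume : Measure (EuclideanSpace ℝ (Fin n))).map g
      = ENNReal.ofReal |A.det|⁻¹ • volume := by
    have hl : LinearMap.det (Matrix.toEuclideanCLM (𝕜 := ℝ) A).toLinearMap = A.det := by
      have h0 : (Matrix.toEuclideanLin : Matrix (Fin n) (Fin n) ℝ ≃ₗ[ℝ] _)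
          = Matrix.toLin (PiLp.basisFun 2 ℝ (Fin n)) (PiLp.basisFun 2 ℝ (Fin n)) :=
        Matrix.toLpLin_eq_toLin 2 2
      rw [Matrix.coe_toEuclideanCLM_eq_toEuclideanLin, h0, LinearMap.det_toLin]
    have h1 : g = (fun x => m + x) ∘ (Matrix.toEuclideanCLM (𝕜 := ℝ) A).toLinearMap := rfl
    have h2 := Measure.map_linearMap_addHaar_eq_smul_addHaar
      (volume : Measure (EuclideanSpace ℝ (Fin n)))
      (f := (Matrix.toEuclideanCLM (𝕜 := ℝ) A).toLinearMap) (by rwa [hl])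
    have h3 : Measurable (Matrix.toEuclideanCLM (𝕜 := ℝ) A).toLinearMap :=
      (Matrix.toEuclideanCLM (𝕜 := ℝ) A).continuous.measurable
    rw [h1, ← Measure.map_map (measurable_const_add m) h3, h2, Measure.map_smul,
      map_add_left_eq_self, hl, abs_inv]
  have hpos : 0 < |A.det| := abs_pos.2 hdet
  -- The factor |det A| split off here cancels the Jacobian factor |det A|⁻¹ from the image of
  -- Lebesgue measure under x ↦ m + A x.
  have hdens : (fun x : EuclideanSpace ℝ (Fin n) =>
      ENNReal.ofReal (Real.exp (-(n / 2 * Real.log (2 * Real.pi)) - ‖x‖ ^ 2 / 2)))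
      = ENNReal.ofReal |A.det| • fun x =>
        ENNReal.ofReal (Real.exp (gaussianLogDensity m S (g x))) := by
    ext x
    rw [Pi.smul_apply, smul_eq_mul, ← ENNReal.ofReal_mul hpos.le, hlog, ← Real.exp_log hpos,
      ← Real.exp_add, Real.log_exp]
    congr 2
    ring
  rw [multivariateGaussian, stdGaussian_eq_withDensity, ← hA, ← hg, hdens,
    withDensity_smul _ (by fun_prop), Measure.map_smul,
    map_withDensity_comp _ hgm (f := fun x => ENNReal.ofReal (Real.exp (gaussianLogDensity m S x)))
      (by fun_prop), hvol, withDensity_smul_measure, smul_smul,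
    ← ENNReal.ofReal_mul hpos.le, mul_inv_cancel₀ hpos.ne', ENNReal.ofReal_one, one_smul]

/-! ### Moments and covariance matrices under linear maps -/

lemma memLp_eval {Ω : Type*} [MeasurableSpace Ω] {P : Measure Ω} {n : ℕ}
    {X : Ω → EuclideanSpace ℝ (Fin n)} (hX : MemLp X 2 P) (i : Fin n) :
    MemLp (fun ω => X ω i) 2 P :=
  (EuclideanSpace.proj (𝕜 := ℝ) i).comp_memLp' hX

lemma memLp_transform {Ω : Type*} [MeasurableSpace Ω] {P : Measure Ω} {n : ℕ}
    {X : Ω → EuclideanSpace ℝ (Fin n)} (hX : MemLp X 2 P) (T : Matrix (Fin n) (Fin n) ℝ) :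
    MemLp (fun ω => transform T (X ω)) 2 P :=
  (Matrix.toEuclideanLin Tᵀ).toContinuousLinearMap.comp_memLp' hX

lemma measurable_transform {n : ℕ} (T : Matrix (Fin n) (Fin n) ℝ) : Measurable (transform T) :=
  (Matrix.toEuclideanLin Tᵀ).toContinuousLinearMap.measurable

lemma transform_apply {n : ℕ} (T : Matrix (Fin n) (Fin n) ℝ) (x : EuclideanSpace ℝ (Fin n))
    (i : Fin n) : transform T x i = ∑ j, T j i * x j := rfl

lemma transform_add {n : ℕ} (T : Matrix (Fin n) (Fin n) ℝ) (x y : EuclideanSpace ℝ (Fin n)) :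
    transform T (x + y) = transform T x + transform T y :=
  (Matrix.toEuclideanLin Tᵀ).map_add x y

@[fun_prop]
lemma measurable_firstPart (M K : ℕ) : Measurable (firstPart M K) := by
  unfold firstPart
  fun_prop

@[fun_prop]
lemma measurable_lastPart (M K : ℕ) : Measurable (lastPart M K) := by
  unfold lastPart
  fun_prop

/-- The projection to the first `M` coordinates as a continuous linear map. -/
def firstPartCLM (M K : ℕ) : EuclideanSpace ℝ (Fin (M + K)) →L[ℝ] EuclideanSpace ℝ (Fin M) :=
  LinearMap.toContinuousLinearMap
    { toFun := firstPart M K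
      map_add' := fun _ _ => rfl
      map_smul' := fun _ _ => rfl }

lemma memLp_firstPart {Ω : Type*} [MeasurableSpace Ω] {P : Measure Ω} {M K : ℕ}
    {X : Ω → EuclideanSpace ℝ (Fin (M + K))} (hX : MemLp X 2 P) :
    MemLp (fun ω => firstPart M K (X ω)) 2 P :=
  (firstPartCLM M K).comp_memLp' hX

lemma memLp_id_map {Ω : Type*} [MeasurableSpace Ω] {P : Measure Ω} {n : ℕ}
    {X : Ω → EuclideanSpace ℝ (Fin n)} (hX : MemLp X 2 P) (hm : AEMeasurable X P) :
    MemLp id 2 (P.map X) :=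
  (memLp_map_measure_iff (by fun_prop) hm).2 hX

lemma covMatrix_map {Ω : Type*} [MeasurableSpace Ω] {P : Measure Ω} {n : ℕ}
    {X : Ω → EuclideanSpace ℝ (Fin n)} (hm : AEMeasurable X P) (i j : Fin n) :
    covMatrix (P.map X) i j = cov[fun ω => X ω i, fun ω => X ω j; P] := by
  rw [covMatrix, Matrix.of_apply,
    covariance_map_fun (Measurable.aestronglyMeasurable (by fun_prop))
      (Measurable.aestronglyMeasurable (by fun_prop)) hm]

lemma covMatrix_map_transform {Ω : Type*} [MeasurableSpace Ω] {P : Measure Ω}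
    [IsProbabilityMeasure P] {n : ℕ} {X : Ω → EuclideanSpace ℝ (Fin n)} (hX : MemLp X 2 P)
    (hm : Measurable X) (T : Matrix (Fin n) (Fin n) ℝ) :
    covMatrix (P.map (fun ω => transform T (X ω))) = Tᵀ * covMatrix (P.map X) * T := by
  ext i j
  rw [covMatrix_map (X := fun ω => transform T (X ω)) ((measurable_transform T).comp hm).aemeasurable]
  simp_rw [transform_apply]
  rw [covariance_fun_sum_fun_sum (fun k => (memLp_eval hX k).const_mul _)
    (fun k => (memLp_eval hX k).const_mul _), Matrix.mul_apply]
  simp_rw [Matrix.mul_apply, covMatrix_map hm.aemeasurable, covariance_const_mul_left,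
    covariance_const_mul_right, Finset.sum_mul]
  rw [Finset.sum_comm]
  refine Finset.sum_congr rfl fun k _ => Finset.sum_congr rfl fun l _ => ?_
  rw [Matrix.transpose_apply]
  ring

lemma covMatrix_map_firstPart {M K : ℕ} (Q : Measure (EuclideanSpace ℝ (Fin (M + K)))) :
    covMatrix (Q.map (firstPart M K))
      = (covMatrix Q).submatrix (Fin.castAdd K) (Fin.castAdd K) := by
  ext i j
  rw [covMatrix_map (measurable_firstPart M K).aemeasurable]
  rfl

lemma covMatrix_map_add {Ω : Type*} [MeasurableSpace Ω] {P : Measure Ω}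
    [IsProbabilityMeasure P] {n : ℕ} {S N : Ω → EuclideanSpace ℝ (Fin n)}
    (hS : MemLp S 2 P) (hN : MemLp N 2 P) (hSm : Measurable S) (hNm : Measurable N)
    (hSN : IndepFun S N P) :
    covMatrix (P.map (fun ω => S ω + N ω)) = covMatrix (P.map S) + covMatrix (P.map N) := by
  have hzero : ∀ i j, cov[fun ω => S ω i, fun ω => N ω j; P] = 0 := fun i j =>
    IndepFun.covariance_eq_zero (hSN.comp (φ := fun x : EuclideanSpace ℝ (Fin n) => x i)
      (ψ := fun x : EuclideanSpace ℝ (Fin n) => x j) (by fun_prop) (by fun_prop))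
      (memLp_eval hS i) (memLp_eval hN j)
  ext i j
  rw [Matrix.add_apply, covMatrix_map (X := fun ω => S ω + N ω) (hSm.add hNm).aemeasurable,
    covMatrix_map hSm.aemeasurable,
    covMatrix_map hNm.aemeasurable]
  have h1 : ∀ i, (fun ω => (S ω + N ω) i) = (fun ω => S ω i) + fun ω => N ω i := fun i => rfl
  rw [h1, h1, covariance_add_left (memLp_eval hS i) (memLp_eval hN i)
    ((memLp_eval hS j).add (memLp_eval hN j)),
    covariance_add_right (memLp_eval hS i) (memLp_eval hS j) (memLp_eval hN j),
    covariance_add_right (memLp_eval hN i) (memLp_eval hS j) (memLp_eval hN j), hzero i j,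
    covariance_comm, covariance_comm (fun ω => N ω i), hzero j i, covariance_comm]
  ring

lemma covMatrix_posSemidef {n : ℕ} {Q : Measure (EuclideanSpace ℝ (Fin n))}
    [IsProbabilityMeasure Q] (hQ : MemLp id 2 Q) : (covMatrix Q).PosSemidef := by
  refine Matrix.PosSemidef.of_dotProduct_mulVec_nonneg ?_ fun x => ?_
  · ext i j
    simp [covMatrix, covariance_comm]
  · have h : star x ⬝ᵥ covMatrix Q *ᵥ x
        = cov[fun y => ∑ i, x i * y i, fun y => ∑ j, x j * y j; Q] := by
      rw [covariance_fun_sum_fun_sum (fun k => (memLp_eval (X := fun y => y) hQ k).const_mul _)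
        (fun k => (memLp_eval (X := fun y => y) hQ k).const_mul _)]
      simp only [dotProduct, Matrix.mulVec, covMatrix, covariance_const_mul_left,
        covariance_const_mul_right, Finset.mul_sum, star_trivial, Matrix.of_apply]
      refine Finset.sum_congr rfl fun k _ => Finset.sum_congr rfl fun l _ => ?_
      ring
    rw [h, covariance_self (Measurable.aemeasurable (by fun_prop))]
    exact variance_nonneg _ _

lemma integral_eval {n : ℕ} {Q : Measure (EuclideanSpace ℝ (Fin n))} (hQ : Integrable id Q)
    (i : Fin n) : (∫ x, x ∂Q) i = ∫ x, x i ∂Q :=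
  ((EuclideanSpace.proj (𝕜 := ℝ) i).integral_comp_comm hQ).symm

/-- The expected logarithm of a Gaussian density under a law with the same moments. -/
lemma integral_gaussianLogDensity {n : ℕ} {Q : Measure (EuclideanSpace ℝ (Fin n))}
    [IsProbabilityMeasure Q] (hQ : MemLp id 2 Q) {m : EuclideanSpace ℝ (Fin n)}
    (hm : ∫ x, x ∂Q = m) {S : Matrix (Fin n) (Fin n) ℝ} (hS : covMatrix Q = S) (hdet : S.det ≠ 0) :
    Integrable (gaussianLogDensity m S) Q ∧
    ∫ x, gaussianLogDensity m S x ∂Q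
      = -(n / 2 * Real.log (2 * Real.pi)) - Real.log S.det / 2 - n / 2 := by
  subst hm
  have hL : ∀ i, MemLp (fun x : EuclideanSpace ℝ (Fin n) => x i - (∫ y, y ∂Q) i) 2 Q :=
    fun i => (memLp_eval hQ i).sub (memLp_const _)
  have hint : ∀ i j, Integrable (fun x : EuclideanSpace ℝ (Fin n) =>
      (x i - (∫ y, y ∂Q) i) * (S⁻¹ i j * (x j - (∫ y, y ∂Q) j))) Q :=
    fun i j => (hL i).integrable_mul ((hL j).const_mul _)
  have hcov : ∀ i j, ∫ x, (x i - (∫ y, y ∂Q) i) * (S⁻¹ i j * (x j - (∫ y, y ∂Q) j)) ∂Q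
      = S⁻¹ i j * S j i := by
    intro i j
    rw [← hS, covMatrix, Matrix.of_apply, covariance_comm, covariance, ← integral_const_mul]
    refine integral_congr_ae (ae_of_all _ fun x => ?_)
    simp only [integral_eval (hQ.integrable one_le_two)]
    ring
  have hquad : Integrable (fun x : EuclideanSpace ℝ (Fin n) =>
      (fun i => x i - (∫ y, y ∂Q) i) ⬝ᵥ S⁻¹ *ᵥ (fun i => x i - (∫ y, y ∂Q) i)) Q := by
    simp only [dotProduct, Matrix.mulVec, Finset.mul_sum]
    exact integrable_finsetSum _ fun i _ => integrable_finsetSum _ fun j _ => hint i j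
  -- The mean of the quadratic form is the trace of S⁻¹S, hence n, whatever the law with these
  -- moments.
  have hval : ∫ x, (fun i => x i - (∫ y, y ∂Q) i) ⬝ᵥ S⁻¹ *ᵥ (fun i => x i - (∫ y, y ∂Q) i) ∂Q
      = n := by
    simp only [dotProduct, Matrix.mulVec, Finset.mul_sum]
    rw [integral_finsetSum _ fun i _ => integrable_finsetSum _ fun j _ => hint i j]
    have h1 : ∀ i, ∫ x, ∑ j, (x i - (∫ y, y ∂Q) i) * (S⁻¹ i j * (x j - (∫ y, y ∂Q) j)) ∂Q
        = (S⁻¹ * S) i i := by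
      intro i
      rw [integral_finsetSum _ fun j _ => hint i j, Matrix.mul_apply]
      exact Finset.sum_congr rfl fun j _ => hcov i j
    simp_rw [h1, Matrix.nonsing_inv_mul _ hdet.isUnit]
    simp
  unfold gaussianLogDensity
  refine ⟨(integrable_const _).sub (hquad.div_const 2), ?_⟩
  rw [integral_sub (integrable_const _) (hquad.div_const 2), integral_div, hval]
  simp

/-! ### Conditional laws with densities -/

section Disintegration

variable {α β : Type*} [MeasurableSpace α] [MeasurableSpace β]

/-- Composing a measure with a kernel that has a density almost everywhere. -/
lemma compProd_eq_withDensity {π : Measure α} [SFinite π] {ν : Measure β} [SFinite ν]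
    {κ : Kernel α β} [IsSFiniteKernel κ] {h : α × β → ℝ≥0∞} (hh : Measurable h)
    (hκ : ∀ᵐ a ∂π, κ a = ν.withDensity (fun b => h (a, b))) :
    π ⊗ₘ κ = (π.prod ν).withDensity h := by
  ext t ht
  rw [Measure.compProd_apply ht, withDensity_apply _ ht, ← lintegral_indicator ht,
    lintegral_prod _ (hh.indicator ht).aemeasurable]
  refine lintegral_congr_ae (hκ.mono fun a ha => ?_)
  have hta : MeasurableSet (Prod.mk a ⁻¹' t) := measurable_prodMk_left ht
  simp only [ha, withDensity_apply _ hta, ← lintegral_indicator hta]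
  rfl

/-- The conditional law has as its density the joint density divided by the marginal density. -/
lemma condKernel_ae_eq_withDensity [StandardBorelSpace β] [Nonempty β]
    {ρ : Measure (α × β)} [IsFiniteMeasure ρ] {μ : Measure α} [SigmaFinite μ] {ν : Measure β}
    [SFinite ν] {f : α × β → ℝ} {g : α → ℝ} (hf : Measurable f) (hg : Measurable g)
    (hρ : ρ = (μ.prod ν).withDensity (fun z => ENNReal.ofReal (Real.exp (f z))))
    (hρ1 : ρ.fst = μ.withDensity (fun a => ENNReal.ofReal (Real.exp (g a)))) :
    ∀ᵐ a ∂μ, ρ.condKernel a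
      = ν.withDensity (fun b => ENNReal.ofReal (Real.exp (f (a, b) - g a))) := by
  set h : α → β → ℝ≥0∞ := fun a b => ENNReal.ofReal (Real.exp (f (a, b) - g a)) with hdef
  have hh : Measurable (Function.uncurry h) := by
    simp only [hdef, Function.uncurry_def]
    fun_prop
  have hha : ∀ a, Measurable (h a) := fun a => hh.comp measurable_prodMk_left
  have hfm : Measurable (fun z => ENNReal.ofReal (Real.exp (f z))) := by fun_prop
  have hgm : Measurable (fun a => ENNReal.ofReal (Real.exp (g a))) := by fun_prop
  have hmul : ∀ a b, ENNReal.ofReal (Real.exp (g a)) * h a b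
      = ENNReal.ofReal (Real.exp (f (a, b))) := by
    intro a b
    rw [hdef, ← ENNReal.ofReal_mul (Real.exp_pos _).le, ← Real.exp_add]
    congr 2
    ring
  have hmass_meas : Measurable (fun a => ∫⁻ b, h a b ∂ν) := hh.lintegral_prod_right'
  -- Integrating the joint density over b gives a second density of the first marginal. It agrees
  -- almost everywhere with exp g, so the quotient integrates to 1.
  have hmass : ∀ᵐ a ∂μ, ∫⁻ b, h a b ∂ν = 1 := by
    have h1 : ρ.fst
        = μ.withDensity (fun a => ∫⁻ b, ENNReal.ofReal (Real.exp (f (a, b))) ∂ν) := by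
      ext t ht
      rw [Measure.fst_apply ht, hρ, withDensity_apply _ (measurable_fst ht),
        withDensity_apply _ ht, ← Set.prod_univ, setLIntegral_prod _ hfm.aemeasurable.restrict]
      simp
    have h3 := (withDensity_eq_iff_of_sigmaFinite hgm.aemeasurable
      (Measurable.lintegral_prod_right' hfm).aemeasurable).1 (hρ1.symm.trans h1)
    filter_upwards [h3] with a ha
    simp_rw [← hmul a] at ha
    rw [lintegral_const_mul _ (hha a)] at ha
    have h2 : ENNReal.ofReal (Real.exp (g a)) ≠ 0 := by simp [Real.exp_pos]
    exact ((ENNReal.mul_right_inj h2 ENNReal.ofReal_ne_top).1 (by rw [mul_one]; exact ha)).symm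
  -- Uniqueness of the disintegration is applied to a finite kernel. The quotient density may have
  -- the wrong mass on a null set, where the kernel is replaced by 0.
  let s : Set α := {a | ∫⁻ b, h a b ∂ν = 1}
  have hs : MeasurableSet s := hmass_meas (measurableSet_singleton 1)
  classical
  let κ : Kernel α β := Kernel.piecewise hs (Kernel.withDensity (Kernel.const α ν) h) 0
  have hκs : ∀ a ∈ s, κ a = ν.withDensity (h a) := by
    intro a ha
    rw [Kernel.piecewise_apply, if_pos ha, Kernel.withDensity_apply _ hh, Kernel.const_apply]
  have hκfin : IsFiniteKernel κ := by
    refine ⟨1, ENNReal.one_lt_top, fun a => ?_⟩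
    by_cases ha : a ∈ s
    · rw [hκs a ha, withDensity_apply _ MeasurableSet.univ, Measure.restrict_univ]
      exact le_of_eq ha
    · rw [Kernel.piecewise_apply, if_neg ha]
      simp
  have hfact : ρ = ρ.fst ⊗ₘ κ := by
    ext t ht
    rw [Measure.compProd_apply ht, hρ1, lintegral_withDensity_eq_lintegral_mul _ hgm
      (Kernel.measurable_kernel_prodMk_left ht)]
    conv_lhs => rw [hρ]
    rw [withDensity_apply _ ht, ← lintegral_indicator ht,
      lintegral_prod _ (hfm.indicator ht).aemeasurable]
    refine lintegral_congr_ae (hmass.mono fun a ha => ?_)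
    have hta : MeasurableSet (Prod.mk a ⁻¹' t) := measurable_prodMk_left ht
    simp only [Pi.mul_apply]
    rw [hκs a ha, withDensity_apply _ hta, ← lintegral_const_mul _ (hha a)]
    simp_rw [hmul]
    rw [← lintegral_indicator hta]
    rfl
  have hae := eq_condKernel_of_measure_eq_compProd κ hfact
  rw [hρ1] at hae
  -- The marginal density exp g is positive, so null sets of the marginal are null for μ as well.
  have hac : μ ≪ μ.withDensity (fun a => ENNReal.ofReal (Real.exp (g a))) :=
    withDensity_absolutelyContinuous' hgm.aemeasurable (by simp [Real.exp_pos])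
  filter_upwards [hac.ae_le hae, hmass] with a ha1 ha2
  rw [← ha1, hκs a ha2]

end Disintegration

/-! ### Splitting a vector into two blocks -/

section Split

variable {M K : ℕ}

/-- Splitting a vector into its first `M` and its last `K` coordinates. -/
def splitEquiv (M K : ℕ) : EuclideanSpace ℝ (Fin (M + K)) ≃ᵐ
    EuclideanSpace ℝ (Fin M) × EuclideanSpace ℝ (Fin K) where
  toFun z := (firstPart M K z, lastPart M K z)
  invFun z := WithLp.toLp 2 (Fin.append z.1 z.2)
  left_inv z := by
    ext i
    refine Fin.addCases (fun i => ?_) (fun i => ?_) i <;> simp [firstPart, lastPart]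
  right_inv z := by
    refine Prod.ext ?_ ?_ <;> ext i <;> simp [firstPart, lastPart]
  measurable_toFun := (measurable_firstPart M K).prodMk (measurable_lastPart M K)
  measurable_invFun := by
    refine (MeasurableEquiv.toLp 2 _).measurable.comp (measurable_pi_lambda _ fun i => ?_)
    refine Fin.addCases (fun i => ?_) (fun i => ?_) i
    · simp only [Fin.append_left]; fun_prop
    · simp only [Fin.append_right]; fun_prop

lemma firstPart_splitEquiv_symm (z : EuclideanSpace ℝ (Fin M) × EuclideanSpace ℝ (Fin K)) :
    firstPart M K ((splitEquiv M K).symm z) = z.1 :=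
  congrArg Prod.fst ((splitEquiv M K).apply_symm_apply z)

lemma splitLaw_eq_map (Q : Measure (EuclideanSpace ℝ (Fin (M + K)))) :
    splitLaw M K Q = Q.map (splitEquiv M K) := rfl

lemma splitLaw_fst (Q : Measure (EuclideanSpace ℝ (Fin (M + K)))) :
    (splitLaw M K Q).fst = Q.map (firstPart M K) := by
  rw [splitLaw_eq_map, Measure.fst, Measure.map_map measurable_fst (splitEquiv M K).measurable]
  rfl

lemma measurePreserving_splitEquiv (M K : ℕ) : MeasurePreserving (splitEquiv M K) := by
  have h1 := PiLp.volume_preserving_ofLp (Fin (M + K))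
  have h2 := (volume_measurePreserving_piCongrLeft (fun _ : Fin (M + K) => ℝ)
    (finSumFinEquiv (m := M) (n := K))).symm
  have h3 := volume_measurePreserving_sumPiEquivProdPi (fun _ : Fin M ⊕ Fin K => ℝ)
  have h4 := (PiLp.volume_preserving_toLp (Fin M)).prod (PiLp.volume_preserving_toLp (Fin K))
  have h := h4.comp (h3.comp (h2.comp h1))
  exact h

end Split

/-! ### Gaussian counterparts: marginals, conditional laws and conditional entropy -/

section GaussianSplit
variable {M K : ℕ}

lemma integral_firstPart {Q : Measure (EuclideanSpace ℝ (Fin (M + K)))} (hQ : Integrable id Q) :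
    ∫ x, x ∂(Q.map (firstPart M K)) = firstPart M K (∫ x, x ∂Q) := by
  rw [integral_map (measurable_firstPart M K).aemeasurable (by fun_prop)]
  exact (firstPartCLM M K).integral_comp_comm hQ

/-- The logarithm of the conditional density of the last `K` coordinates given the first `M`
coordinates, for the Gaussian law with mean `m` and covariance matrix `C`. -/
def gaussianLogCondDensity (M K : ℕ) (m : EuclideanSpace ℝ (Fin (M + K)))
    (C : Matrix (Fin (M + K)) (Fin (M + K)) ℝ) (x : EuclideanSpace ℝ (Fin (M + K))) : ℝ :=
  gaussianLogDensity m C x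
    - gaussianLogDensity (firstPart M K m) (C.submatrix (Fin.castAdd K) (Fin.castAdd K))
        (firstPart M K x)

@[fun_prop]
lemma measurable_gaussianLogCondDensity (m : EuclideanSpace ℝ (Fin (M + K)))
    (C : Matrix (Fin (M + K)) (Fin (M + K)) ℝ) : Measurable (gaussianLogCondDensity M K m C) := by
  unfold gaussianLogCondDensity
  fun_prop

lemma posDef_submatrix_castAdd {C : Matrix (Fin (M + K)) (Fin (M + K)) ℝ} (hC : C.PosDef) :
    (C.submatrix (Fin.castAdd K) (Fin.castAdd K)).PosDef :=
  hC.submatrix (Fin.castAdd_injective M K)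

/-- The integrand is quadratic, so its mean depends only on the first two moments of Q, and Q need
not be Gaussian. The value is therefore the same for Q and for its Gaussian counterpart, where it is
minus the conditional entropy. -/
lemma integral_gaussianLogCondDensity {Q : Measure (EuclideanSpace ℝ (Fin (M + K)))}
    [IsProbabilityMeasure Q] (hQ : MemLp id 2 Q) {m : EuclideanSpace ℝ (Fin (M + K))}
    (hm : ∫ x, x ∂Q = m) {C : Matrix (Fin (M + K)) (Fin (M + K)) ℝ} (hC : covMatrix Q = C)
    (hpos : C.PosDef) :
    Integrable (gaussianLogCondDensity M K m C) Q ∧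
    ∫ x, gaussianLogCondDensity M K m C x ∂Q
      = -(K / 2 * Real.log (2 * Real.pi)) - (Real.log C.det
        - Real.log (C.submatrix (Fin.castAdd K) (Fin.castAdd K)).det) / 2 - K / 2 := by
  have hmeas : AEMeasurable (firstPart M K) Q := (measurable_firstPart M K).aemeasurable
  have : IsProbabilityMeasure (Q.map (firstPart M K)) := Measure.isProbabilityMeasure_map hmeas
  have h1 := integral_gaussianLogDensity hQ hm hC hpos.det_pos.ne'
  have h2 := integral_gaussianLogDensity (Q := Q.map (firstPart M K))
    (m := firstPart M K m) (S := C.submatrix (Fin.castAdd K) (Fin.castAdd K))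
    (memLp_id_map (memLp_firstPart hQ) hmeas)
    (by rw [integral_firstPart (hQ.integrable one_le_two), hm])
    (by rw [covMatrix_map_firstPart, hC]) (posDef_submatrix_castAdd hpos).det_pos.ne'
  have h3 : Integrable (fun x => gaussianLogDensity (firstPart M K m)
      (C.submatrix (Fin.castAdd K) (Fin.castAdd K)) (firstPart M K x)) Q :=
    (integrable_map_measure (by fun_prop) hmeas).1 h2.1
  refine ⟨h1.1.sub h3, ?_⟩
  have h4 := h2.2
  rw [integral_map hmeas (by fun_prop)] at h4
  unfold gaussianLogCondDensity
  rw [integral_sub h1.1 h3, h1.2, h4]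
  push_cast
  ring

section Counterpart

variable {n : ℕ} {Q : Measure (EuclideanSpace ℝ (Fin n))}

instance isGaussian_gaussianCounterpart : IsGaussian (gaussianCounterpart Q) := by
  unfold gaussianCounterpart; infer_instance

lemma integral_gaussianCounterpart : ∫ x, x ∂(gaussianCounterpart Q) = ∫ x, x ∂Q :=
  integral_id_multivariateGaussian

lemma covMatrix_gaussianCounterpart (hQ : (covMatrix Q).PosSemidef) :
    covMatrix (gaussianCounterpart Q) = covMatrix Q := by
  ext i j
  exact covariance_eval_multivariateGaussian hQ i j

end Counterpart

lemma eq_of_isGaussian_of_covMatrix_eq {n : ℕ} {Q Q' : Measure (EuclideanSpace ℝ (Fin n))}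
    [IsGaussian Q] [IsGaussian Q'] (hm : ∫ x, x ∂Q = ∫ x, x ∂Q')
    (hC : covMatrix Q = covMatrix Q') : Q = Q' := by
  refine IsGaussian.ext hm ?_
  rw [← ContinuousLinearMap.toBilinForm_inj]
  refine LinearMap.BilinForm.ext_basis (EuclideanSpace.basisFun (Fin n) ℝ).toBasis fun i j => ?_
  rw [ContinuousLinearMap.toBilinForm_apply, ContinuousLinearMap.toBilinForm_apply,
    covarianceBilin_apply_eq_cov IsGaussian.memLp_two_id,
    covarianceBilin_apply_eq_cov IsGaussian.memLp_two_id]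
  have h : ∀ i, (fun u => inner ℝ ((EuclideanSpace.basisFun (Fin n) ℝ).toBasis i) u)
      = fun u : EuclideanSpace ℝ (Fin n) => u i := by
    intro i; ext u; simp [PiLp.inner_apply]
  rw [h, h]
  exact congrFun (congrFun hC i) j

variable {Q : Measure (EuclideanSpace ℝ (Fin (M + K)))} [IsProbabilityMeasure Q]

/-- Both sides are Gaussian with the same mean and covariance matrix. This identifies the marginal
density by which the joint Gaussian density is divided. -/
lemma gaussianCounterpart_map_firstPart (hQ : MemLp id 2 Q) :
    (gaussianCounterpart Q).map (firstPart M K) = gaussianCounterpart (Q.map (firstPart M K)) := by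
  have hmeas : AEMeasurable (firstPart M K) Q := (measurable_firstPart M K).aemeasurable
  have : IsProbabilityMeasure (Q.map (firstPart M K)) := Measure.isProbabilityMeasure_map hmeas
  have hQ1 : MemLp id 2 (Q.map (firstPart M K)) := memLp_id_map (memLp_firstPart hQ) hmeas
  have hG : IsGaussian ((gaussianCounterpart Q).map (firstPart M K)) :=
    inferInstanceAs (IsGaussian ((gaussianCounterpart Q).map (firstPartCLM M K)))
  apply eq_of_isGaussian_of_covMatrix_eq
  · rw [integral_firstPart IsGaussian.integrable_id, integral_gaussianCounterpart,
      integral_gaussianCounterpart, integral_firstPart (hQ.integrable one_le_two)]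
  · rw [covMatrix_map_firstPart, covMatrix_gaussianCounterpart (covMatrix_posSemidef hQ),
      covMatrix_gaussianCounterpart (covMatrix_posSemidef hQ1),
      covMatrix_map_firstPart]

lemma gaussianCounterpart_eq_withDensity {n : ℕ} {Q : Measure (EuclideanSpace ℝ (Fin n))}
    (hpos : (covMatrix Q).PosDef) :
    gaussianCounterpart Q = volume.withDensity (fun x =>
      ENNReal.ofReal (Real.exp (gaussianLogDensity (∫ x, x ∂Q) (covMatrix Q) x))) :=
  multivariateGaussian_eq_withDensity _ hpos

omit [IsProbabilityMeasure Q] in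
lemma splitLaw_gaussianCounterpart (hpos : (covMatrix Q).PosDef) :
    splitLaw M K (gaussianCounterpart Q) = (volume.prod volume).withDensity (fun z =>
      ENNReal.ofReal (Real.exp (gaussianLogDensity (∫ x, x ∂Q) (covMatrix Q)
        ((splitEquiv M K).symm z)))) := by
  rw [splitLaw_eq_map, gaussianCounterpart_eq_withDensity hpos]
  have h := map_withDensity_comp (volume : Measure (EuclideanSpace ℝ (Fin (M + K))))
    (splitEquiv M K).measurable (f := fun z => ENNReal.ofReal (Real.exp (gaussianLogDensity
      (∫ x, x ∂Q) (covMatrix Q) ((splitEquiv M K).symm z)))) (by fun_prop)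
  rw [(measurePreserving_splitEquiv M K).map_eq] at h
  simp only [MeasurableEquiv.symm_apply_apply] at h
  exact h

lemma splitLaw_gaussianCounterpart_fst (hQ : MemLp id 2 Q) (hpos : (covMatrix Q).PosDef) :
    (splitLaw M K (gaussianCounterpart Q)).fst = volume.withDensity (fun u =>
      ENNReal.ofReal (Real.exp (gaussianLogDensity (firstPart M K (∫ x, x ∂Q))
        ((covMatrix Q).submatrix (Fin.castAdd K) (Fin.castAdd K)) u))) := by
  rw [splitLaw_fst, gaussianCounterpart_map_firstPart hQ, gaussianCounterpart_eq_withDensity,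
    covMatrix_map_firstPart, integral_firstPart (hQ.integrable one_le_two)]
  rw [covMatrix_map_firstPart]
  exact posDef_submatrix_castAdd hpos

lemma gaussianLogCondDensity_symm (m : EuclideanSpace ℝ (Fin (M + K)))
    (C : Matrix (Fin (M + K)) (Fin (M + K)) ℝ)
    (z : EuclideanSpace ℝ (Fin M) × EuclideanSpace ℝ (Fin K)) :
    gaussianLogCondDensity M K m C ((splitEquiv M K).symm z)
      = gaussianLogDensity m C ((splitEquiv M K).symm z)
        - gaussianLogDensity (firstPart M K m) (C.submatrix (Fin.castAdd K) (Fin.castAdd K)) z.1 := by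
  rw [gaussianLogCondDensity, firstPart_splitEquiv_symm]

/-- The conditional law of the Gaussian counterpart has the Gaussian conditional density. -/
lemma condKernel_gaussianCounterpart (hQ : MemLp id 2 Q) (hpos : (covMatrix Q).PosDef) :
    ∀ᵐ u ∂(volume : Measure (EuclideanSpace ℝ (Fin M))),
      (splitLaw M K (gaussianCounterpart Q)).condKernel u = volume.withDensity (fun v =>
        ENNReal.ofReal (Real.exp (gaussianLogCondDensity M K (∫ x, x ∂Q) (covMatrix Q)
          ((splitEquiv M K).symm (u, v))))) := by
  simp_rw [gaussianLogCondDensity_symm]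
  exact condKernel_ae_eq_withDensity
    (f := fun z => gaussianLogDensity (∫ x, x ∂Q) (covMatrix Q) ((splitEquiv M K).symm z))
    (by fun_prop) (by fun_prop) (splitLaw_gaussianCounterpart hpos)
    (splitLaw_gaussianCounterpart_fst hQ hpos)

/-- The conditional entropy of the Gaussian counterpart. -/
lemma gaussianCondEntropy_eq (hQ : MemLp id 2 Q) (hpos : (covMatrix Q).PosDef) :
    gaussianCondEntropy M K Q = K / 2 * Real.log (2 * Real.pi) + (Real.log (covMatrix Q).det
        - Real.log ((covMatrix Q).submatrix (Fin.castAdd K) (Fin.castAdd K)).det) / 2 + K / 2 := by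
  set p := splitLaw M K (gaussianCounterpart Q) with hp
  have hpd := splitLaw_gaussianCounterpart (M := M) (K := K) hpos
  have hpd1 := splitLaw_gaussianCounterpart_fst (M := M) (K := K) hQ hpos
  rw [← hp] at hpd hpd1
  have hr : p.rnDeriv volume =ᵐ[p] fun z => ENNReal.ofReal (Real.exp
      (gaussianLogDensity (∫ x, x ∂Q) (covMatrix Q) ((splitEquiv M K).symm z))) := by
    have h := Measure.rnDeriv_withDensity (volume.prod volume) (f := fun z => ENNReal.ofReal
      (Real.exp (gaussianLogDensity (∫ x, x ∂Q) (covMatrix Q) ((splitEquiv M K).symm z))))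
      (by fun_prop)
    rw [← hpd] at h
    have hac : p ≪ volume.prod volume := by rw [hpd]; exact withDensity_absolutelyContinuous _ _
    exact hac.ae_le h
  have hr1 : ∀ᵐ z ∂p, p.fst.rnDeriv volume z.1 = ENNReal.ofReal (Real.exp
      (gaussianLogDensity (firstPart M K (∫ x, x ∂Q))
        ((covMatrix Q).submatrix (Fin.castAdd K) (Fin.castAdd K)) z.1)) := by
    have h := Measure.rnDeriv_withDensity (volume : Measure (EuclideanSpace ℝ (Fin M)))
      (f := fun u => ENNReal.ofReal (Real.exp (gaussianLogDensity (firstPart M K (∫ x, x ∂Q))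
        ((covMatrix Q).submatrix (Fin.castAdd K) (Fin.castAdd K)) u))) (by fun_prop)
    rw [← hpd1] at h
    have hac : p.fst ≪ volume := by rw [hpd1]; exact withDensity_absolutelyContinuous _ _
    exact ae_of_ae_map measurable_fst.aemeasurable (hac.ae_le h)
  have hG := integral_gaussianLogCondDensity (M := M) (K := K) (Q := gaussianCounterpart Q)
    IsGaussian.memLp_two_id integral_gaussianCounterpart
    (covMatrix_gaussianCounterpart hpos.posSemidef) hpos
  have hint : ∫ z, Real.log ((p.rnDeriv volume z).toReal / (p.fst.rnDeriv volume z.1).toReal) ∂p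
      = ∫ x, gaussianLogCondDensity M K (∫ x, x ∂Q) (covMatrix Q) x ∂(gaussianCounterpart Q) := by
    have h1 : ∫ z, Real.log ((p.rnDeriv volume z).toReal / (p.fst.rnDeriv volume z.1).toReal) ∂p
        = ∫ z, gaussianLogCondDensity M K (∫ x, x ∂Q) (covMatrix Q) ((splitEquiv M K).symm z) ∂p := by
      refine integral_congr_ae ?_
      filter_upwards [hr, hr1] with z hz hz1
      rw [hz, hz1, ENNReal.toReal_ofReal (Real.exp_pos _).le,
        ENNReal.toReal_ofReal (Real.exp_pos _).le, ← Real.exp_sub, Real.log_exp,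
        gaussianLogCondDensity_symm]
    rw [h1, hp, splitLaw_eq_map, integral_map_equiv]
    simp only [MeasurableEquiv.symm_apply_apply]
  rw [gaussianCondEntropy, condDiffEntropy, ← hp, hint, hG.2]
  ring

lemma integral_gaussianLogCondDensity_eq_neg_gaussianCondEntropy (hQ : MemLp id 2 Q)
    (hpos : (covMatrix Q).PosDef) :
    ∫ x, gaussianLogCondDensity M K (∫ x, x ∂Q) (covMatrix Q) x ∂Q
      = -gaussianCondEntropy M K Q := by
  rw [gaussianCondEntropy_eq hQ hpos, (integral_gaussianLogCondDensity hQ rfl rfl hpos).2]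
  ring

end GaussianSplit

/-! ### A determinant inequality from Cauchy–Binet -/

/-- Expansion of the determinant of a product of rectangular matrices. -/
lemma det_mul_eq_sum {M n : ℕ} (B : Matrix (Fin M) (Fin n) ℝ) (A : Matrix (Fin n) (Fin M) ℝ) :
    (B * A).det = ∑ f : Fin M → Fin n, (∏ i, B i (f i)) * (A.submatrix f id).det := by
  have h : B * A = fun i => ∑ k, B i k • A k := by
    ext i j
    simp [Matrix.mul_apply, Finset.sum_apply]
  have h2 := (Matrix.detRowAlternating (n := Fin M) (R := ℝ)).toMultilinearMap.map_sum
    (fun i k => B i k • A k)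
  have h3 : (B * A).det = ∑ f : Fin M → Fin n,
      Matrix.detRowAlternating (fun i => B i (f i) • A (f i)) := by
    rw [h]; exact h2
  rw [h3]
  refine Finset.sum_congr rfl fun f _ => ?_
  exact (Matrix.detRowAlternating (n := Fin M) (R := ℝ)).toMultilinearMap.map_smul_univ
    (fun i => B i (f i)) (fun i => A (f i))

/-- A form of the Cauchy–Binet formula. -/
lemma factorial_mul_det_transpose_mul_diagonal_mul {M n : ℕ} (A : Matrix (Fin n) (Fin M) ℝ)
    (d : Fin n → ℝ) :
    (M.factorial : ℝ) * (Aᵀ * Matrix.diagonal d * A).det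
      = ∑ f : Fin M → Fin n, (∏ i, d (f i)) * (A.submatrix f id).det ^ 2 := by
  have h0 : (Aᵀ * Matrix.diagonal d * A).det = ∑ f : Fin M → Fin n,
      (∏ i, d (f i)) * (∏ i, A (f i) i) * (A.submatrix f id).det := by
    rw [det_mul_eq_sum]
    refine Finset.sum_congr rfl fun f _ => ?_
    congr 1
    rw [← Finset.prod_mul_distrib]
    refine Finset.prod_congr rfl fun i _ => ?_
    rw [Matrix.mul_diagonal, Matrix.transpose_apply, mul_comm]
  -- Replacing f by f ∘ σ leaves the weight ∏ d unchanged and multiplies the minor by sign σ.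
  -- Summing over all M! permutations then assembles the product of entries into a second copy of
  -- the minor, by the Leibniz formula.
  have hσ : ∀ σ : Equiv.Perm (Fin M), (Aᵀ * Matrix.diagonal d * A).det
      = ∑ f : Fin M → Fin n, (∏ i, d (f i)) * ((Equiv.Perm.sign σ : ℤ) * ∏ i, A (f (σ i)) i) *
        (A.submatrix f id).det := by
    intro σ
    rw [h0, ← (Equiv.arrowCongr σ.symm (Equiv.refl (Fin n))).sum_comp]
    refine Finset.sum_congr rfl fun f _ => ?_
    have e : (Equiv.arrowCongr σ.symm (Equiv.refl (Fin n))) f = f ∘ σ := by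
      ext i; simp
    rw [e]
    have h1 : (A.submatrix (f ∘ σ) id).det
        = (Equiv.Perm.sign σ : ℤ) * (A.submatrix f id).det := by
      have := Matrix.det_permute σ (A.submatrix f id)
      rw [Matrix.submatrix_submatrix] at this
      simpa using this
    have h2 : ∏ i, d ((f ∘ σ) i) = ∏ i, d (f i) := Equiv.prod_comp σ (fun i => d (f i))
    rw [h1, h2]
    simp only [Function.comp]
    ring
  have hcard : (M.factorial : ℝ) * (Aᵀ * Matrix.diagonal d * A).det
      = ∑ _σ : Equiv.Perm (Fin M), (Aᵀ * Matrix.diagonal d * A).det := by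
    rw [Finset.sum_const, Finset.card_univ, Fintype.card_perm, Fintype.card_fin, nsmul_eq_mul]
  rw [hcard, Finset.sum_congr rfl fun σ _ => hσ σ, Finset.sum_comm]
  refine Finset.sum_congr rfl fun f _ => ?_
  rw [← Finset.sum_mul, ← Finset.mul_sum]
  have : ∑ σ : Equiv.Perm (Fin M), ((Equiv.Perm.sign σ : ℤ) : ℝ) * ∏ i, A (f (σ i)) i
      = (A.submatrix f id).det := by
    rw [Matrix.det_apply']
    rfl
  rw [this]
  ring

/-- List the image of f in increasing order: its k-th element (counted from 0) is at least k, so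
each factor is dominated by the corresponding leading value of the antitone d. -/
lemma prod_comp_injective_le {M K : ℕ} {d : Fin (M + K) → ℝ} (hd : Antitone d)
    (hpos : ∀ i, 0 ≤ d i) {f : Fin M → Fin (M + K)} (hf : Function.Injective f) :
    ∏ i, d (f i) ≤ ∏ i, d (Fin.castAdd K i) := by
  have hcard : (Finset.univ.image f).card = M := by
    rw [Finset.card_image_of_injective _ hf, Finset.card_univ, Fintype.card_fin]
  let e := (Finset.univ.image f).orderEmbOfFin hcard
  have h1 : ∏ i, d (f i) = ∏ i, d (e i) := by
    rw [← Finset.prod_image (s := Finset.univ) (g := f) (f := d) (fun a _ b _ h => hf h),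
      ← Finset.prod_image (s := Finset.univ) (g := e) (f := d) (fun a _ b _ h => e.injective h),
      Finset.image_orderEmbOfFin_univ]
  have h2 : ∀ (k : ℕ) (hk : k < M), k ≤ (e ⟨k, hk⟩ : ℕ) := by
    intro k
    induction k with
    | zero => intro _; exact Nat.zero_le _
    | succ k ih =>
      intro hk
      have h3 : e ⟨k, by omega⟩ < e ⟨k + 1, hk⟩ := e.strictMono (by simp [Fin.lt_def])
      have h4 := ih (by omega)
      rw [Fin.lt_def] at h3
      omega
  rw [h1]
  refine Finset.prod_le_prod (fun i _ => hpos _) fun i _ => hd ?_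
  rw [Fin.le_def]
  exact h2 i i.2

/-- The determinant of a compression is at most the product of the largest eigenvalues. -/
lemma det_transpose_mul_diagonal_mul_le {M K : ℕ} {d : Fin (M + K) → ℝ} (hd : Antitone d)
    (hpos : ∀ i, 0 ≤ d i) (A : Matrix (Fin (M + K)) (Fin M) ℝ) :
    (Aᵀ * Matrix.diagonal d * A).det ≤ (∏ i, d (Fin.castAdd K i)) * (Aᵀ * A).det := by
  have h1 := factorial_mul_det_transpose_mul_diagonal_mul A d
  have h2 := factorial_mul_det_transpose_mul_diagonal_mul A 1
  rw [show Matrix.diagonal (1 : Fin (M + K) → ℝ) = 1 from Matrix.diagonal_one,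
    Matrix.mul_one] at h2
  have hM : (0 : ℝ) < M.factorial := by positivity
  refine le_of_mul_le_mul_left ?_ hM
  rw [h1, mul_left_comm, h2, Finset.mul_sum]
  refine Finset.sum_le_sum fun f _ => ?_
  -- For non-injective f two rows of the minor coincide and it vanishes, so only products over
  -- distinct indices have to be compared.
  by_cases hf : Function.Injective f
  · simpa using mul_le_mul_of_nonneg_right (prod_comp_injective_le hd hpos hf) (sq_nonneg _)
  · have h0 : (A.submatrix f id).det = 0 := by
      simp only [Function.Injective, not_forall] at hf
      obtain ⟨i, j, hij, hne⟩ := hf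
      exact Matrix.det_zero_of_row_eq hne (by ext k; simp [hij])
    simp [h0]

/-! ### Kullback–Leibler divergence: chain rule and change of reference measure -/

section ChainRule

variable {α β γ δ : Type*} [MeasurableSpace α] [MeasurableSpace β] [MeasurableSpace γ]
  [MeasurableSpace δ]

lemma klDiv_map_measurableEquiv (μ ν : Measure α) [IsFiniteMeasure μ] [IsFiniteMeasure ν]
    (e : α ≃ᵐ β) : klDiv (μ.map e) (ν.map e) = klDiv μ ν := by
  refine le_antisymm (klDiv_map_le μ ν e.measurable) ?_
  have h := klDiv_map_le (μ.map e) (ν.map e) e.symm.measurable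
  rwa [Measure.map_map e.symm.measurable e.measurable,
    Measure.map_map e.symm.measurable e.measurable, e.symm_comp_self, Measure.map_id,
    Measure.map_id] at h

/-- After swapping the factors, the common law μ is a constant kernel on both sides, and a common
kernel does not change the divergence. -/
lemma klDiv_prod_left (μ : Measure α) [IsProbabilityMeasure μ] (ν ν' : Measure β)
    [IsFiniteMeasure ν] [IsFiniteMeasure ν'] :
    klDiv (μ.prod ν) (μ.prod ν') = klDiv ν ν' := by
  rw [← klDiv_map_measurableEquiv _ _ MeasurableEquiv.prodComm]
  have h : ∀ ν : Measure β, [IsFiniteMeasure ν] →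
      (μ.prod ν).map MeasurableEquiv.prodComm = ν ⊗ₘ Kernel.const β μ := by
    intro ν _
    rw [Measure.compProd_const]
    exact Measure.prod_swap
  rw [h, h, klDiv_compProd_left]

lemma map_compProd_of_eq_comp (μ : Measure α) [SFinite μ] {g : α → β} (hg : Measurable g)
    (κ : Kernel β γ) [IsSFiniteKernel κ] (η : Kernel α γ) [IsSFiniteKernel η]
    (h : ∀ a, η a = κ (g a)) :
    (μ ⊗ₘ η).map (Prod.map g id) = (μ.map g) ⊗ₘ κ := by
  have hm : Measurable (Prod.map g (id : γ → γ)) := hg.prodMap measurable_id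
  ext t ht
  rw [Measure.map_apply hm ht, Measure.compProd_apply (hm ht), Measure.compProd_apply ht,
    lintegral_map (Kernel.measurable_kernel_prodMk_left ht) hg]
  refine lintegral_congr fun a => ?_
  rw [h]
  rfl

lemma map_prodAssoc_symm_prod_compProd (μ : Measure α) [SFinite μ] (ν : Measure β) [SFinite ν]
    (κ : Kernel β γ) [IsSFiniteKernel κ] :
    (μ.prod (ν ⊗ₘ κ)).map MeasurableEquiv.prodAssoc.symm
      = (μ.prod ν) ⊗ₘ (Kernel.prodMkLeft α κ) := by
  ext t ht
  rw [MeasurableEquiv.map_apply, Measure.prod_apply (MeasurableEquiv.prodAssoc.symm.measurable ht),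
    Measure.compProd_apply ht,
    lintegral_prod _ (Kernel.measurable_kernel_prodMk_left ht).aemeasurable]
  refine lintegral_congr fun a => ?_
  rw [Measure.compProd_apply
    (measurable_prodMk_left (MeasurableEquiv.prodAssoc.symm.measurable ht))]
  rfl

/-- Two ways of expanding the divergence of the law of `(U, (V, W))` from the law under which `U`
is independent of `(V, W)` and `W` has the conditional law `κ` given `V`. -/
lemma klDiv_add_klDiv_eq [StandardBorelSpace α] [Nonempty α] [StandardBorelSpace γ] [Nonempty γ]
    (ρ : Measure (α × β × γ)) [IsProbabilityMeasure ρ] (κ : Kernel β γ) [IsMarkovKernel κ] :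
    klDiv ρ.snd (ρ.snd.fst ⊗ₘ κ) + klDiv ρ (ρ.fst.prod ρ.snd)
      = klDiv (ρ.map (fun z => (z.1, z.2.1))) (ρ.fst.prod ρ.snd.fst)
        + klDiv (ρ.map MeasurableEquiv.prodAssoc.symm)
            (ρ.map (fun z => (z.1, z.2.1)) ⊗ₘ Kernel.prodMkLeft α κ) := by
  -- Under the reference law of the middle term, U is independent of (V, W) and W has law κ given V.
  -- The left side arises by splitting off (V, W) first, the right side by splitting off (U, V)
  -- first.
  trans klDiv ρ (ρ.fst.prod (ρ.snd.fst ⊗ₘ κ))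
  · have hsw : ∀ ν : Measure (β × γ), [IsFiniteMeasure ν] →
        (ρ.fst.prod ν).map MeasurableEquiv.prodComm = ν ⊗ₘ Kernel.const (β × γ) ρ.fst := by
      intro ν _
      rw [Measure.compProd_const]
      exact Measure.prod_swap
    have hρ : ρ.map MeasurableEquiv.prodComm
        = ρ.snd ⊗ₘ (ρ.map MeasurableEquiv.prodComm).condKernel := by
      have h := (ρ.map MeasurableEquiv.prodComm).disintegrate
        (ρ.map MeasurableEquiv.prodComm).condKernel
      have h1 : (ρ.map MeasurableEquiv.prodComm).fst = ρ.snd := Measure.fst_map_swap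
      rw [h1] at h
      exact h.symm
    rw [← klDiv_map_measurableEquiv ρ (ρ.fst.prod ρ.snd) MeasurableEquiv.prodComm,
      ← klDiv_map_measurableEquiv ρ (ρ.fst.prod (ρ.snd.fst ⊗ₘ κ)) MeasurableEquiv.prodComm,
      hsw, hsw, hρ, klDiv_compProd_eq_add ρ.snd (ρ.snd.fst ⊗ₘ κ)]
  · rw [← klDiv_map_measurableEquiv ρ (ρ.fst.prod (ρ.snd.fst ⊗ₘ κ)) MeasurableEquiv.prodAssoc.symm,
      map_prodAssoc_symm_prod_compProd]
    set ρ' := ρ.map MeasurableEquiv.prodAssoc.symm with hρ'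
    have h1 : ρ'.fst = ρ.map (fun z => (z.1, z.2.1)) := by
      rw [hρ', Measure.fst, Measure.map_map measurable_fst (MeasurableEquiv.measurable _)]
      rfl
    have h2 : ρ' = ρ.map (fun z => (z.1, z.2.1)) ⊗ₘ ρ'.condKernel := by
      rw [← h1]
      exact (ρ'.disintegrate ρ'.condKernel).symm
    rw [h2]
    have : IsProbabilityMeasure (ρ.map (fun z => (z.1, z.2.1))) :=
      Measure.isProbabilityMeasure_map (by fun_prop)
    exact klDiv_compProd_eq_add _ _ _ _

end ChainRule

/-- Reweighting the reference law by exp f lowers the log-likelihood ratio by f. This replaces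
differences of entropies, which may be undefined: one finite divergence and integrability of f
suffice. -/
lemma klDiv_withDensity_exp_right {α : Type*} [MeasurableSpace α] {μ ν : Measure α}
    [IsProbabilityMeasure μ] [IsProbabilityMeasure ν] (h : klDiv μ ν ≠ ∞) {f : α → ℝ}
    (hf : Measurable f) (hfμ : Integrable f μ)
    (hmass : ∫⁻ x, ENNReal.ofReal (Real.exp (f x)) ∂ν = 1) :
    klDiv μ (ν.withDensity (fun x => ENNReal.ofReal (Real.exp (f x)))) ≠ ∞ ∧
    (klDiv μ (ν.withDensity (fun x => ENNReal.ofReal (Real.exp (f x))))).toReal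
      = (klDiv μ ν).toReal - ∫ x, f x ∂μ := by
  obtain ⟨hac, hint⟩ := klDiv_ne_top_iff.1 h
  have hexp : Integrable (fun x => Real.exp (f x)) ν := by
    refine ⟨by fun_prop, ?_⟩
    rw [hasFiniteIntegral_iff_ofReal (ae_of_all _ fun x => (Real.exp_pos _).le), hmass]
    exact ENNReal.one_lt_top
  have hone : ∫ x, Real.exp (f x) ∂ν = 1 := by
    rw [integral_eq_lintegral_of_nonneg_ae (ae_of_all _ fun x => (Real.exp_pos _).le)
      (by fun_prop), hmass, ENNReal.toReal_one]
  -- The total mass 1 makes the normalizing constant of the exponential tilt trivial.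
  have htilt : ν.withDensity (fun x => ENNReal.ofReal (Real.exp (f x))) = ν.tilted f := by
    simp [Measure.tilted, hone]
  have hprob : IsProbabilityMeasure (ν.tilted f) := isProbabilityMeasure_tilted hexp
  have hac' : μ ≪ ν.tilted f := hac.trans (absolutelyContinuous_tilted hexp)
  have hint' : Integrable (llr μ (ν.tilted f)) μ := integrable_llr_tilted_right hac hfμ hint hexp
  rw [htilt]
  refine ⟨klDiv_ne_top hac' hint', ?_⟩
  rw [toReal_klDiv_of_measure_eq hac' (by simp), integral_llr_tilted_right hac hfμ hexp hint,
    hone, Real.log_one, toReal_klDiv_of_measure_eq hac (by simp), add_zero]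

/-! ### Divergence of a randomly shifted vector -/

section Shift

variable {A E F : Type*} [MeasurableSpace A] [MeasureSpace E] [MeasureSpace F]
  [AddCommGroup E] [AddCommGroup F] [MeasurableAdd₂ E] [MeasurableAdd₂ F]
  [SigmaFinite (volume : Measure F)]
  [(volume : Measure E).IsAddLeftInvariant] [(volume : Measure F).IsAddLeftInvariant]

/-- The shift `(s, (u, v)) ↦ ((s, t₁ s + u), t₂ s + v)`. -/
def shiftMap (t₁ : A → E) (t₂ : A → F) (z : A × E × F) : (A × E) × F :=
  ((z.1, t₁ z.1 + z.2.1), t₂ z.1 + z.2.2)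

variable {t₁ : A → E} {t₂ : A → F}

omit [SigmaFinite (volume : Measure F)] [(volume : Measure E).IsAddLeftInvariant]
  [(volume : Measure F).IsAddLeftInvariant] in
lemma measurable_shiftMap (ht₁ : Measurable t₁) (ht₂ : Measurable t₂) :
    Measurable (shiftMap t₁ t₂) := by
  unfold shiftMap
  fun_prop

-- For fixed s and u the last coordinate is only translated, by t₂ s, and this preserves Lebesgue
-- measure.
omit [(volume : Measure E).IsAddLeftInvariant] in
lemma map_shiftMap_prod_volume (ht₁ : Measurable t₁) (ht₂ : Measurable t₂) (p : Measure A)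
    [SFinite p] (m : Measure E) [SFinite m] :
    (p.prod (m.prod volume)).map (shiftMap t₁ t₂)
      = ((p.prod m).map (fun z => (z.1, t₁ z.1 + z.2))).prod volume := by
  have hm : Measurable (fun z : A × E => (z.1, t₁ z.1 + z.2)) := by fun_prop
  ext B hB
  have hB' := measurable_shiftMap ht₁ ht₂ hB
  rw [Measure.map_apply (measurable_shiftMap ht₁ ht₂) hB, Measure.prod_apply hB',
    Measure.prod_apply hB, lintegral_map (measurable_measure_prodMk_left hB) hm,
    lintegral_prod (fun z : A × E => volume (Prod.mk (z.1, t₁ z.1 + z.2) ⁻¹' B))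
      ((measurable_measure_prodMk_left hB).comp hm).aemeasurable]
  refine lintegral_congr fun s => ?_
  rw [Measure.prod_apply (measurable_prodMk_left hB')]
  refine lintegral_congr fun u => ?_
  exact measure_preimage_add volume (t₂ s) (Prod.mk (s, t₁ s + u) ⁻¹' B)

/-- Each translate of a null set is null, and averaging over s keeps it null. -/
lemma map_shift_absolutelyContinuous (ht₁ : Measurable t₁) (p : Measure A) [SFinite p]
    (m : Measure E) [SFinite m] (hm : m ≪ volume) :
    (p.prod m).map (fun z => t₁ z.1 + z.2) ≪ volume := by
  refine Measure.AbsolutelyContinuous.mk fun B hB h0 => ?_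
  have hmeas : Measurable (fun z : A × E => t₁ z.1 + z.2) := by fun_prop
  rw [Measure.map_apply hmeas hB, Measure.prod_apply (hmeas hB)]
  refine lintegral_eq_zero_of_ae_eq_zero (ae_of_all _ fun s => hm ?_)
  exact (measure_preimage_add volume (t₁ s) B).trans h0

/-- The conditional divergence of a randomly shifted vector from a kernel with a density. -/
lemma klDiv_map_shiftMap_le (ht₁ : Measurable t₁) (ht₂ : Measurable t₂) (p : Measure A)
    [IsProbabilityMeasure p] (q : Measure (E × F)) [IsProbabilityMeasure q]
    (hq : q.fst ≪ volume) (κ η : Kernel E F) [IsMarkovKernel κ] [IsMarkovKernel η]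
    {f g : E × F → ℝ} (hf : Measurable f) (hg : Measurable g)
    (hκ : ∀ᵐ u ∂(volume : Measure E), κ u
      = volume.withDensity (fun v => ENNReal.ofReal (Real.exp (f (u, v)))))
    (hη : ∀ᵐ u ∂(volume : Measure E), η u
      = volume.withDensity (fun v => ENNReal.ofReal (Real.exp (g (u, v)))))
    (hfi : Integrable f q)
    (hgi : Integrable (fun z => g (t₁ z.1 + z.2.1, t₂ z.1 + z.2.2)) (p.prod q))
    (hfin : klDiv q (q.fst ⊗ₘ κ) ≠ ∞) :
    klDiv ((p.prod q).map (shiftMap t₁ t₂))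
      ((p.prod q).map (fun z => (z.1, t₁ z.1 + z.2.1)) ⊗ₘ Kernel.prodMkLeft A η) ≠ ∞ ∧
    (klDiv ((p.prod q).map (shiftMap t₁ t₂))
      ((p.prod q).map (fun z => (z.1, t₁ z.1 + z.2.1)) ⊗ₘ Kernel.prodMkLeft A η)).toReal
      ≤ (klDiv q (q.fst ⊗ₘ κ)).toReal
        + ∫ z, f z ∂q - ∫ z, g (t₁ z.1 + z.2.1, t₂ z.1 + z.2.2) ∂(p.prod q) := by
  set π := (p.prod q.fst).map (fun z => (z.1, t₁ z.1 + z.2)) with hπdef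
  have hmeas : Measurable (fun z : A × E => (z.1, t₁ z.1 + z.2)) := by fun_prop
  have hπprob : IsProbabilityMeasure π := Measure.isProbabilityMeasure_map hmeas.aemeasurable
  have hπ : (p.prod q).map (fun z => (z.1, t₁ z.1 + z.2.1)) = π := by
    have h1 : p.prod q.fst = (p.prod q).map (Prod.map id Prod.fst) := by
      rw [Measure.fst, ← Measure.map_prod_map _ _ measurable_id measurable_fst, Measure.map_id]
    rw [hπdef, h1, Measure.map_map hmeas (by fun_prop)]
    rfl
  have hπη : π ⊗ₘ Kernel.prodMkLeft A η = (π.prod volume).withDensity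
      (fun w => ENNReal.ofReal (Real.exp (g (w.1.2, w.2)))) := by
    refine compProd_eq_withDensity (by fun_prop) ?_
    -- The formula for η holds only almost everywhere with respect to Lebesgue measure; absolute
    -- continuity of the shifted first block transfers it to π.
    have hac : π.map Prod.snd ≪ volume := by
      rw [hπdef, Measure.map_map measurable_snd hmeas]
      exact map_shift_absolutelyContinuous ht₁ p q.fst hq
    filter_upwards [ae_of_ae_map measurable_snd.aemeasurable (hac.ae_le hη)] with a ha
    rw [Kernel.prodMkLeft_apply, ha]
  have hκq : q.fst ⊗ₘ κ = (q.fst.prod volume).withDensity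
      (fun w => ENNReal.ofReal (Real.exp (f w))) :=
    compProd_eq_withDensity (by fun_prop) (hq.ae_le hκ)
  -- Reweighting by exp k exchanges the density exp f of κ for exp g at the shifted point. The image
  -- under the shift is then exactly the reference law built from η.
  set k : A × E × F → ℝ := fun z => g (t₁ z.1 + z.2.1, t₂ z.1 + z.2.2) - f z.2 with hk
  have hkm : Measurable k := by fun_prop
  have hfi' : Integrable (fun z : A × E × F => f z.2) (p.prod q) := hfi.comp_snd p
  have hdens : (p.prod (q.fst ⊗ₘ κ)).withDensity (fun z => ENNReal.ofReal (Real.exp (k z)))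
      = (p.prod (q.fst.prod volume)).withDensity (fun z =>
        ENNReal.ofReal (Real.exp (g (t₁ z.1 + z.2.1, t₂ z.1 + z.2.2)))) := by
    rw [hκq, prod_withDensity_right (by fun_prop), ← withDensity_mul _ (by fun_prop) (by fun_prop)]
    congr 1
    ext z
    rw [Pi.mul_apply, ← ENNReal.ofReal_mul (Real.exp_pos _).le, ← Real.exp_add, hk]
    congr 2
    ring
  have hmap : ((p.prod (q.fst ⊗ₘ κ)).withDensity
      (fun z => ENNReal.ofReal (Real.exp (k z)))).map (shiftMap t₁ t₂)
        = π ⊗ₘ Kernel.prodMkLeft A η := by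
    rw [hπη, hπdef, ← map_shiftMap_prod_volume ht₁ ht₂, hdens]
    exact map_withDensity_comp _ (measurable_shiftMap ht₁ ht₂)
      (f := fun w => ENNReal.ofReal (Real.exp (g (w.1.2, w.2)))) (by fun_prop)
  -- The image of the reweighted measure is a probability measure, so its mass is 1.
  have hmass : ∫⁻ z, ENNReal.ofReal (Real.exp (k z)) ∂(p.prod (q.fst ⊗ₘ κ)) = 1 := by
    have h := DFunLike.congr_fun hmap Set.univ
    rw [Measure.map_apply (measurable_shiftMap ht₁ ht₂) MeasurableSet.univ, Set.preimage_univ,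
      withDensity_apply _ MeasurableSet.univ, Measure.restrict_univ] at h
    rw [h, measure_univ]
  have hkl : klDiv (p.prod q) (p.prod (q.fst ⊗ₘ κ)) = klDiv q (q.fst ⊗ₘ κ) := klDiv_prod_left _ _ _
  have hmain := klDiv_withDensity_exp_right (by rwa [hkl]) hkm (hgi.sub hfi') hmass
  have hfinite : IsFiniteMeasure ((p.prod (q.fst ⊗ₘ κ)).withDensity
      (fun z => ENNReal.ofReal (Real.exp (k z)))) :=
    isFiniteMeasure_withDensity (by rw [hmass]; exact ENNReal.one_ne_top)
  rw [hπ, ← hmap]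
  have hle := klDiv_map_le (p.prod q) ((p.prod (q.fst ⊗ₘ κ)).withDensity
    (fun z => ENNReal.ofReal (Real.exp (k z)))) (measurable_shiftMap ht₁ ht₂)
  refine ⟨ne_top_of_le_ne_top hmain.1 hle, (ENNReal.toReal_mono hmain.1 hle).trans (le_of_eq ?_)⟩
  rw [hmain.2, hkl, hk, integral_sub hgi hfi', integral_fun_snd]
  simp only [probReal_univ, one_smul]
  ring

end Shift

/-! ### From conditional divergences to the relevant loss -/

section Loss

variable {Ω : Type*} [MeasurableSpace Ω] {P : Measure Ω} [IsProbabilityMeasure P]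

lemma mutualInfo_comp_le {α β γ : Type*} [MeasurableSpace α] [MeasurableSpace β]
    [MeasurableSpace γ] {U : Ω → α} {V : Ω → β} (hU : Measurable U) (hV : Measurable V)
    {g : β → γ} (hg : Measurable g) :
    mutualInfo P U (fun ω => g (V ω)) ≤ mutualInfo P U V := by
  have h := klDiv_map_le (P.map (fun ω => (U ω, V ω))) ((P.map U).prod (P.map V))
    (g := Prod.map id g) (measurable_id.prodMap hg)
  rw [Measure.map_map (by fun_prop) (by fun_prop),
    ← Measure.map_prod_map _ _ measurable_id hg, Measure.map_id, Measure.map_map hg hV] at h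
  exact h

/-- The information about a function of `S` carried by `(V, W)`, compared with that carried by `V`
alone. -/
lemma klDiv_add_mutualInfo_le {σ α E F : Type*} [MeasurableSpace σ] [MeasurableSpace α]
    [MeasurableSpace E] [MeasurableSpace F] [StandardBorelSpace α] [StandardBorelSpace F]
    [Nonempty F] {S : Ω → σ} {V : Ω → E} {W : Ω → F} (hS : Measurable S) (hV : Measurable V)
    (hW : Measurable W) {c : σ → α} (hc : Measurable c) (κ : Kernel E F) [IsMarkovKernel κ] :
    klDiv (P.map (fun ω => (V ω, W ω))) (P.map V ⊗ₘ κ)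
        + mutualInfo P (fun ω => c (S ω)) (fun ω => (V ω, W ω))
      ≤ mutualInfo P (fun ω => c (S ω)) V
        + klDiv (P.map (fun ω => ((S ω, V ω), W ω)))
            (P.map (fun ω => (S ω, V ω)) ⊗ₘ Kernel.prodMkLeft σ κ) := by
  have : Nonempty α := (nonempty_of_isProbabilityMeasure P).map fun ω => c (S ω)
  set ρ := P.map (fun ω => (c (S ω), V ω, W ω)) with hρ
  have hρm : Measurable (fun ω => (c (S ω), V ω, W ω)) := by fun_prop
  have hρprob : IsProbabilityMeasure ρ := Measure.isProbabilityMeasure_map hρm.aemeasurable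
  have h1 : ρ.fst = P.map (fun ω => c (S ω)) := by
    rw [hρ, Measure.fst, Measure.map_map measurable_fst hρm]; rfl
  have h2 : ρ.snd = P.map (fun ω => (V ω, W ω)) := by
    rw [hρ, Measure.snd, Measure.map_map measurable_snd hρm]; rfl
  have h3 : ρ.snd.fst = P.map V := by
    rw [h2, Measure.fst, Measure.map_map measurable_fst (by fun_prop)]; rfl
  have h4 : ρ.map (fun z => (z.1, z.2.1)) = P.map (fun ω => (c (S ω), V ω)) := by
    rw [hρ, Measure.map_map (by fun_prop) hρm]; rfl
  have h5 : ρ.map MeasurableEquiv.prodAssoc.symm = P.map (fun ω => ((c (S ω), V ω), W ω)) := by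
    rw [hρ, Measure.map_map (MeasurableEquiv.measurable _) hρm]; rfl
  have hchain := klDiv_add_klDiv_eq ρ κ
  rw [h3, h2, h1, h4, h5] at hchain
  have hSV : IsProbabilityMeasure (P.map (fun ω => (S ω, V ω))) :=
    Measure.isProbabilityMeasure_map (by fun_prop)
  have hdp := klDiv_map_le (P.map (fun ω => ((S ω, V ω), W ω)))
    (P.map (fun ω => (S ω, V ω)) ⊗ₘ Kernel.prodMkLeft σ κ)
    (g := Prod.map (Prod.map c id) id) (by fun_prop)
  rw [Measure.map_map (by fun_prop) (by fun_prop),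
    map_compProd_of_eq_comp _ (g := Prod.map c id) (by fun_prop) (Kernel.prodMkLeft α κ)
      (Kernel.prodMkLeft σ κ) (fun _ => rfl), Measure.map_map (by fun_prop) (by fun_prop)] at hdp
  exact hchain.le.trans (add_le_add le_rfl hdp)

/-- Data processing for the map that forgets S, under which the reference kernel is unaffected. It
makes J(Y_c|Y_M) finite and the Gaussian bound nonnegative. -/
lemma klDiv_le_klDiv_prodMkLeft {σ E F : Type*} [MeasurableSpace σ]
    [MeasurableSpace E] [MeasurableSpace F] {S : Ω → σ} {V : Ω → E} {W : Ω → F}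
    (hS : Measurable S) (hV : Measurable V) (hW : Measurable W) (κ : Kernel E F)
    [IsMarkovKernel κ] :
    klDiv (P.map (fun ω => (V ω, W ω))) (P.map V ⊗ₘ κ)
      ≤ klDiv (P.map (fun ω => ((S ω, V ω), W ω)))
          (P.map (fun ω => (S ω, V ω)) ⊗ₘ Kernel.prodMkLeft σ κ) := by
  have hSV : IsProbabilityMeasure (P.map (fun ω => (S ω, V ω))) :=
    Measure.isProbabilityMeasure_map (by fun_prop)
  have hdp := klDiv_map_le (P.map (fun ω => ((S ω, V ω), W ω)))
    (P.map (fun ω => (S ω, V ω)) ⊗ₘ Kernel.prodMkLeft σ κ)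
    (g := Prod.map Prod.snd id) (by fun_prop)
  rw [Measure.map_map (by fun_prop) (by fun_prop),
    map_compProd_of_eq_comp _ measurable_snd κ (Kernel.prodMkLeft σ κ) (fun _ => rfl),
    Measure.map_map (by fun_prop) (by fun_prop)] at hdp
  exact hdp

/-- If the conditional divergence of `W` given `(S, V)` exceeds that of `W` given `V` by at most
`b`, then the relevant information loss is at most `b`. -/
lemma relevantLoss_le_ofReal {σ χ E F : Type*} [MeasurableSpace σ] [MeasurableSpace χ]
    [MeasurableSpace E] [MeasurableSpace F] [StandardBorelSpace F] [Nonempty F]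
    {S : Ω → σ} {X : Ω → χ} {V : Ω → E} {W : Ω → F} (hS : Measurable S) (hV : Measurable V)
    (hW : Measurable W) {r : E × F → χ} (hr : Measurable r) (hX : ∀ ω, X ω = r (V ω, W ω))
    (κ : Kernel E F) [IsMarkovKernel κ]
    (hfin : klDiv (P.map (fun ω => (V ω, W ω))) (P.map V ⊗ₘ κ) ≠ ∞) {b : ℝ}
    (hb : klDiv (P.map (fun ω => ((S ω, V ω), W ω)))
        (P.map (fun ω => (S ω, V ω)) ⊗ₘ Kernel.prodMkLeft σ κ)
      ≤ klDiv (P.map (fun ω => (V ω, W ω))) (P.map V ⊗ₘ κ) + ENNReal.ofReal b) :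
    relevantLoss P S X V ≤ ENNReal.ofReal b := by
  refine iSup_le fun k => iSup_le fun c => iSup_le fun hc => ?_
  rw [tsub_le_iff_right, add_comm]
  have h1 := klDiv_add_mutualInfo_le (P := P) hS hV hW hc κ
  have h2 : mutualInfo P (fun ω => c (S ω)) X
      ≤ mutualInfo P (fun ω => c (S ω)) (fun ω => (V ω, W ω)) := by
    rw [funext hX]
    exact mutualInfo_comp_le (hc.comp hS) (hV.prodMk hW) hr
  -- The divergence of (V, W) stands on both sides and may be cancelled because it is finite.
  refine h2.trans ((ENNReal.add_le_add_iff_left hfin).1 (h1.trans ?_))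
  calc _ ≤ mutualInfo P (fun ω => c (S ω)) V
        + (klDiv (P.map (fun ω => (V ω, W ω))) (P.map V ⊗ₘ κ) + ENNReal.ofReal b) := by gcongr
    _ = _ := by ring

end Loss

/-! ### The loss is at most the Gaussian upper bound -/

section Bound

variable {Ω : Type*} [MeasurableSpace Ω] {P : Measure Ω} [IsProbabilityMeasure P] {M K : ℕ}
  {S N X : Ω → EuclideanSpace ℝ (Fin (M + K))}

lemma transform_nonsing_inv_transform {n : ℕ} {T : Matrix (Fin n) (Fin n) ℝ} (hT : IsUnit T)
    (x : EuclideanSpace ℝ (Fin n)) : transform T⁻¹ (transform T x) = x := by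
  ext i
  have h : (T⁻¹)ᵀ *ᵥ (Tᵀ *ᵥ fun i => x i) = fun i => x i := by
    rw [Matrix.mulVec_mulVec, ← Matrix.transpose_mul,
      Matrix.mul_nonsing_inv _ ((Matrix.isUnit_iff_isUnit_det T).1 hT), Matrix.transpose_one,
      Matrix.one_mulVec]
  exact congrFun h i

lemma quasiMeasurePreserving_transform {n : ℕ} {T : Matrix (Fin n) (Fin n) ℝ} (hT : IsUnit T) :
    Measure.QuasiMeasurePreserving (transform T) := by
  refine Measure.LinearMap.quasiMeasurePreserving volume (Matrix.toEuclideanLin Tᵀ) ?_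
  have h0 : (Matrix.toEuclideanLin : Matrix (Fin n) (Fin n) ℝ ≃ₗ[ℝ] _)
      = Matrix.toLin (PiLp.basisFun 2 ℝ (Fin n)) (PiLp.basisFun 2 ℝ (Fin n)) :=
    Matrix.toLpLin_eq_toLin 2 2
  rw [h0, LinearMap.det_toLin, Matrix.det_transpose]
  exact ((Matrix.isUnit_iff_isUnit_det T).1 hT).ne_zero

/-- The conditional divergence of the last coordinates of `Tᵀ X` given `S` and the first coordinates
of `Tᵀ X`, from the Gaussian conditional law. -/
lemma klDiv_transform_le (hS : Measurable S) (hN : Measurable N)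
    (hX : ∀ ω, X ω = S ω + N ω) (hX2 : MemLp X 2 P) (hN2 : MemLp N 2 P)
    (hNac : P.map N ≪ volume) (hSN : IndepFun S N P) {T : Matrix (Fin (M + K)) (Fin (M + K)) ℝ}
    (hT : IsUnit T) (hXpos : (covMatrix (P.map (fun ω => transform T (X ω)))).PosDef)
    (hNpos : (covMatrix (P.map (fun ω => transform T (N ω)))).PosDef)
    (hJ : condDivergence M K (P.map (fun ω => transform T (N ω))) ≠ ∞) :
    klDiv (P.map (fun ω => ((S ω, firstPart M K (transform T (X ω))),
          lastPart M K (transform T (X ω)))))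
        (P.map (fun ω => (S ω, firstPart M K (transform T (X ω)))) ⊗ₘ Kernel.prodMkLeft _
          (splitLaw M K (gaussianCounterpart
            (P.map (fun ω => transform T (X ω))))).condKernel) ≠ ∞ ∧
    (klDiv (P.map (fun ω => ((S ω, firstPart M K (transform T (X ω))),
          lastPart M K (transform T (X ω)))))
        (P.map (fun ω => (S ω, firstPart M K (transform T (X ω)))) ⊗ₘ Kernel.prodMkLeft _
          (splitLaw M K (gaussianCounterpart
            (P.map (fun ω => transform T (X ω))))).condKernel)).toReal
      ≤ (condDivergence M K (P.map (fun ω => transform T (N ω)))).toReal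
        + gaussianBound M K P X N T := by
  have hXm : Measurable X := by rw [funext hX]; exact hS.add hN
  have hTm := measurable_transform T
  have hTX : Measurable (fun ω => transform T (X ω)) := hTm.comp hXm
  have hTN : Measurable (fun ω => transform T (N ω)) := hTm.comp hN
  set QX := P.map (fun ω => transform T (X ω)) with hQX
  set QN := P.map (fun ω => transform T (N ω)) with hQN
  have hQXp : IsProbabilityMeasure QX :=
    Measure.isProbabilityMeasure_map hTX.aemeasurable
  have hQNp : IsProbabilityMeasure QN :=
    Measure.isProbabilityMeasure_map hTN.aemeasurable
  have hQX2 : MemLp id 2 QX := memLp_id_map (memLp_transform hX2 T) hTX.aemeasurable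
  have hQN2 : MemLp id 2 QN := memLp_id_map (memLp_transform hN2 T) hTN.aemeasurable
  let t₁ := fun s => firstPart M K (transform T s)
  let t₂ := fun s => lastPart M K (transform T s)
  have ht₁ : Measurable t₁ := (measurable_firstPart M K).comp hTm
  have ht₂ : Measurable t₂ := (measurable_lastPart M K).comp hTm
  have hq : splitLaw M K QN = P.map (fun ω => (t₁ (N ω), t₂ (N ω))) := by
    rw [hQN, splitLaw_eq_map, Measure.map_map (splitEquiv M K).measurable hTN]
    rfl
  have hp : IsProbabilityMeasure (P.map S) := Measure.isProbabilityMeasure_map hS.aemeasurable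
  have hqp : IsProbabilityMeasure (splitLaw M K QN) :=
    Measure.isProbabilityMeasure_map (splitEquiv M K).measurable.aemeasurable
  have hprod : (P.map S).prod (splitLaw M K QN) = P.map (fun ω => (S ω, t₁ (N ω), t₂ (N ω))) := by
    have hind : IndepFun S (fun ω => (t₁ (N ω), t₂ (N ω))) P :=
      hSN.comp measurable_id (ht₁.prodMk ht₂)
    rw [hq]
    exact ((indepFun_iff_map_prod_eq_prod_map_map hS.aemeasurable (by fun_prop)).1 hind).symm
  have hadd₁ : ∀ ω, t₁ (S ω) + t₁ (N ω) = t₁ (X ω) := by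
    intro ω
    simp only [t₁]
    rw [hX, transform_add]
    rfl
  have hadd₂ : ∀ ω, t₂ (S ω) + t₂ (N ω) = t₂ (X ω) := by
    intro ω
    simp only [t₂]
    rw [hX, transform_add]
    rfl
  have hjm : Measurable (fun ω => (S ω, t₁ (N ω), t₂ (N ω))) := by fun_prop
  have hlaw : ((P.map S).prod (splitLaw M K QN)).map (shiftMap t₁ t₂)
      = P.map (fun ω => ((S ω, t₁ (X ω)), t₂ (X ω))) := by
    rw [hprod, Measure.map_map (measurable_shiftMap ht₁ ht₂) hjm]
    congr 1
    ext1 ω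
    simp only [Function.comp, shiftMap, hadd₁, hadd₂]
  have hlaw1 : ((P.map S).prod (splitLaw M K QN)).map (fun z => (z.1, t₁ z.1 + z.2.1))
      = P.map (fun ω => (S ω, t₁ (X ω))) := by
    rw [hprod, Measure.map_map (by fun_prop) hjm]
    congr 1
    ext1 ω
    simp only [Function.comp, hadd₁]
  -- Invertibility of T carries the density of N over to Tᵀ N, and hence to its first block.
  have hqac : (splitLaw M K QN).fst ≪ volume := by
    have h1 : QN ≪ volume := by
      rw [hQN, ← Function.comp_def, ← Measure.map_map hTm hN]
      exact (hNac.map hTm).trans (quasiMeasurePreserving_transform hT).absolutelyContinuous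
    have h2 : splitLaw M K QN ≪ volume := by
      rw [splitLaw_eq_map, ← (measurePreserving_splitEquiv M K).map_eq]
      exact h1.map (splitEquiv M K).measurable
    exact (h2.map measurable_fst).trans Measure.quasiMeasurePreserving_fst.absolutelyContinuous
  set f := fun z => gaussianLogCondDensity M K (∫ x, x ∂QN) (covMatrix QN)
    ((splitEquiv M K).symm z) with hf
  set g := fun z => gaussianLogCondDensity M K (∫ x, x ∂QX) (covMatrix QX)
    ((splitEquiv M K).symm z) with hg
  have hfm : Measurable f := by fun_prop
  have hgm : Measurable g := by fun_prop
  have hfi : Integrable f (splitLaw M K QN) := by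
    rw [splitLaw_eq_map, integrable_map_equiv]
    simpa only [hf, Function.comp_def, MeasurableEquiv.symm_apply_apply] using
      (integral_gaussianLogCondDensity hQN2 rfl rfl hNpos).1
  have hfv : ∫ z, f z ∂(splitLaw M K QN) = -gaussianCondEntropy M K QN := by
    rw [splitLaw_eq_map, integral_map_equiv]
    simp only [hf, MeasurableEquiv.symm_apply_apply]
    exact integral_gaussianLogCondDensity_eq_neg_gaussianCondEntropy hQN2 hNpos
  have hgX : ∀ ω, g (t₁ (S ω) + t₁ (N ω), t₂ (S ω) + t₂ (N ω))
      = gaussianLogCondDensity M K (∫ x, x ∂QX) (covMatrix QX) (transform T (X ω)) := by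
    intro ω
    have h : (splitEquiv M K).symm (t₁ (X ω), t₂ (X ω)) = transform T (X ω) :=
      (splitEquiv M K).symm_apply_apply (transform T (X ω))
    rw [hadd₁, hadd₂, hg]
    simp only [h]
  have hgt : Measurable (fun z : EuclideanSpace ℝ (Fin (M + K)) × EuclideanSpace ℝ (Fin M) ×
      EuclideanSpace ℝ (Fin K) => g (t₁ z.1 + z.2.1, t₂ z.1 + z.2.2)) :=
    hgm.comp (by fun_prop)
  have hgi : Integrable (fun z => g (t₁ z.1 + z.2.1, t₂ z.1 + z.2.2))
      ((P.map S).prod (splitLaw M K QN)) := by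
    rw [hprod, integrable_map_measure hgt.aestronglyMeasurable hjm.aemeasurable]
    simp only [Function.comp_def, hgX]
    exact (integrable_map_measure (by fun_prop) hTX.aemeasurable).1
      (integral_gaussianLogCondDensity hQX2 rfl rfl hXpos).1
  have hgv : ∫ z, g (t₁ z.1 + z.2.1, t₂ z.1 + z.2.2) ∂((P.map S).prod (splitLaw M K QN))
      = -gaussianCondEntropy M K QX := by
    rw [hprod, integral_map hjm.aemeasurable hgt.aestronglyMeasurable]
    simp only [hgX]
    rw [← integral_gaussianLogCondDensity_eq_neg_gaussianCondEntropy hQX2 hXpos]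
    exact (integral_map hTX.aemeasurable (by fun_prop)).symm
  obtain ⟨hD, hDle⟩ := klDiv_map_shiftMap_le ht₁ ht₂ (P.map S) (splitLaw M K QN) hqac
    (splitLaw M K (gaussianCounterpart QN)).condKernel
    (splitLaw M K (gaussianCounterpart QX)).condKernel hfm hgm
    (condKernel_gaussianCounterpart hQN2 hNpos) (condKernel_gaussianCounterpart hQX2 hXpos)
    hfi hgi hJ
  rw [hlaw, hlaw1] at hD hDle
  rw [hfv, hgv] at hDle
  refine ⟨hD, hDle.trans (le_of_eq ?_)⟩
  rw [gaussianBound, condDivergence]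
  ring

/-- The relevant information loss is at most the Gaussian upper bound. -/
lemma relevantLoss_le_gaussianBound (hS : Measurable S) (hN : Measurable N)
    (hX : ∀ ω, X ω = S ω + N ω) (hX2 : MemLp X 2 P) (hN2 : MemLp N 2 P)
    (hNac : P.map N ≪ volume) (hSN : IndepFun S N P) {T : Matrix (Fin (M + K)) (Fin (M + K)) ℝ}
    (hT : IsUnit T) (hXpos : (covMatrix (P.map (fun ω => transform T (X ω)))).PosDef)
    (hNpos : (covMatrix (P.map (fun ω => transform T (N ω)))).PosDef)
    (hJ : MoreGaussian M K P X N T) :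
    (relevantLoss P S X (fun ω => firstPart M K (transform T (X ω))) : EReal)
      ≤ (gaussianBound M K P X N T : EReal) := by
  have hXm : Measurable X := by rw [funext hX]; exact hS.add hN
  have hTm := measurable_transform T
  have hTX : Measurable (fun ω => transform T (X ω)) := hTm.comp hXm
  obtain ⟨hD, hDle⟩ := klDiv_transform_le hS hN hX hX2 hN2 hNac hSN hT hXpos hNpos hJ.1
  set QX := P.map (fun ω => transform T (X ω)) with hQX
  set QN := P.map (fun ω => transform T (N ω)) with hQN
  have hVm : Measurable (fun ω => firstPart M K (transform T (X ω))) :=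
    (measurable_firstPart M K).comp hTX
  have hWm : Measurable (fun ω => lastPart M K (transform T (X ω))) :=
    (measurable_lastPart M K).comp hTX
  have hJX : condDivergence M K QX = klDiv (P.map (fun ω =>
        (firstPart M K (transform T (X ω)), lastPart M K (transform T (X ω)))))
      (P.map (fun ω => firstPart M K (transform T (X ω))) ⊗ₘ
        (splitLaw M K (gaussianCounterpart QX)).condKernel) := by
    have h1 : splitLaw M K QX = P.map (fun ω =>
        (firstPart M K (transform T (X ω)), lastPart M K (transform T (X ω)))) := by
      rw [hQX, splitLaw_eq_map, Measure.map_map (splitEquiv M K).measurable hTX]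
      rfl
    rw [condDivergence, h1, Measure.fst, Measure.map_map measurable_fst (hVm.prodMk hWm)]
    rfl
  have hJD := klDiv_le_klDiv_prodMkLeft (P := P) hS hVm hWm
    (splitLaw M K (gaussianCounterpart QX)).condKernel
  rw [← hJX] at hJD
  have hJXfin : condDivergence M K QX ≠ ∞ := ne_top_of_le_ne_top hD hJD
  have hJle : (condDivergence M K QN).toReal ≤ (condDivergence M K QX).toReal :=
    ENNReal.toReal_mono hJXfin hJ.2
  have hJDle := ENNReal.toReal_mono hD hJD
  -- With D the divergence given S, J(Ñ_c|Ñ_M) ≤ J(Y_c|Y_M) ≤ D ≤ J(Ñ_c|Ñ_M) + B. Nonnegativity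
  -- ensures that `ENNReal.ofReal` does not truncate B.
  have hB : 0 ≤ gaussianBound M K P X N T := by linarith
  have hloss := relevantLoss_le_ofReal (P := P) (X := X) (b := gaussianBound M K P X N T) hS hVm hWm
    -- X is recovered from both blocks of Y by undoing the split and applying the inverse of T.
    (r := fun z => transform T⁻¹ ((splitEquiv M K).symm z))
    ((measurable_transform _).comp (splitEquiv M K).symm.measurable)
    (fun ω => by
      have h := (splitEquiv M K).symm_apply_apply (transform T (X ω))
      exact (transform_nonsing_inv_transform hT (X ω)).symm.trans (congrArg _ h.symm))
    (splitLaw M K (gaussianCounterpart QX)).condKernel (by rwa [← hJX]) (by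
      rw [← hJX, ← ENNReal.toReal_le_toReal hD (ENNReal.add_ne_top.2 ⟨hJXfin, ENNReal.ofReal_ne_top⟩),
        ENNReal.toReal_add hJXfin ENNReal.ofReal_ne_top, ENNReal.toReal_ofReal hB]
      linarith)
  calc (relevantLoss P S X (fun ω => firstPart M K (transform T (X ω))) : EReal)
      ≤ ((ENNReal.ofReal (gaussianBound M K P X N T) : ℝ≥0∞) : EReal) :=
        EReal.coe_ennreal_le_coe_ennreal_iff.2 hloss
    _ = (gaussianBound M K P X N T : EReal) := by rw [EReal.coe_ennreal_ofReal, max_eq_left hB]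

end Bound

/-! ### The Gaussian upper bound as a ratio of determinants -/

section Determinants

variable {M K : ℕ}

lemma posDef_transpose_mul_mul {n : ℕ} {C T : Matrix (Fin n) (Fin n) ℝ} (hC : C.PosDef)
    (hT : IsUnit T) : (Tᵀ * C * T).PosDef := by
  have h := hC.conjTranspose_mul_mul_same (Matrix.mulVec_injective_of_isUnit hT)
  rwa [Matrix.conjTranspose_eq_transpose_of_trivial] at h

lemma submatrix_transpose_mul_mul {n m : ℕ} (T C : Matrix (Fin n) (Fin n) ℝ) (e : Fin m → Fin n) :
    (Tᵀ * C * T).submatrix e e = (T.submatrix id e)ᵀ * C * T.submatrix id e := rfl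

variable {Ω : Type*} [MeasurableSpace Ω] {P : Measure Ω} [IsProbabilityMeasure P]
  {N X : Ω → EuclideanSpace ℝ (Fin (M + K))}

/-- The Gaussian upper bound in terms of the covariance matrix of `X`. -/
lemma gaussianBound_eq (hXm : Measurable X) (hNm : Measurable N) (hX2 : MemLp X 2 P)
    (hN2 : MemLp N 2 P) {μ : ℝ} (hμ : 0 < μ) (hCN : covMatrix (P.map N) = μ • 1)
    (hCX : (covMatrix (P.map X)).PosDef) {T : Matrix (Fin (M + K)) (Fin (M + K)) ℝ}
    (hT : IsUnit T) :
    gaussianBound M K P X N T = (Real.log (covMatrix (P.map X)).det - K * Real.log μ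
      + Real.log ((T.submatrix id (Fin.castAdd K))ᵀ * T.submatrix id (Fin.castAdd K)).det
      - Real.log ((T.submatrix id (Fin.castAdd K))ᵀ * covMatrix (P.map X)
          * T.submatrix id (Fin.castAdd K)).det) / 2 := by
  have hTm := measurable_transform T
  have hQX2 := memLp_id_map (memLp_transform hX2 T) (hTm.comp hXm).aemeasurable
  have hQN2 := memLp_id_map (memLp_transform hN2 T) (hTm.comp hNm).aemeasurable
  have hQXp : IsProbabilityMeasure (P.map (fun ω => transform T (X ω))) :=
    Measure.isProbabilityMeasure_map (hTm.comp hXm).aemeasurable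
  have hQNp : IsProbabilityMeasure (P.map (fun ω => transform T (N ω))) :=
    Measure.isProbabilityMeasure_map (hTm.comp hNm).aemeasurable
  have hX := covMatrix_map_transform hX2 hXm T
  have hN := covMatrix_map_transform hN2 hNm T
  have hone : (1 : Matrix (Fin (M + K)) (Fin (M + K)) ℝ).PosDef := Matrix.PosDef.one
  have hNpos : (covMatrix (P.map N)).PosDef := by rw [hCN]; exact hone.smul hμ
  have hTT := posDef_transpose_mul_mul hone hT
  have hTT1 := posDef_submatrix_castAdd hTT
  rw [submatrix_transpose_mul_mul, Matrix.mul_one] at hTT1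
  rw [Matrix.mul_one] at hTT
  rw [gaussianBound, gaussianCondEntropy_eq hQX2 (by rw [hX]; exact posDef_transpose_mul_mul hCX hT),
    gaussianCondEntropy_eq hQN2 (by rw [hN]; exact posDef_transpose_mul_mul hNpos hT), hX, hN,
    submatrix_transpose_mul_mul, submatrix_transpose_mul_mul, hCN]
  simp only [Matrix.mul_smul, Matrix.smul_mul, Matrix.mul_one, Matrix.det_smul, Fintype.card_fin]
  -- The term ln det(TᵀT) occurs for X and for N and cancels in the difference. Of the powers of μ,
  -- the full determinant contributes M + K and the block M, which leaves K.
  have h1 : Real.log (Tᵀ * covMatrix (P.map X) * T).det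
      = Real.log (Tᵀ * T).det + Real.log (covMatrix (P.map X)).det := by
    rw [← Real.log_mul hTT.det_pos.ne' hCX.det_pos.ne']
    simp only [Matrix.det_mul]
    congr 1
    ring
  rw [h1, Real.log_mul (pow_pos hμ _).ne' hTT.det_pos.ne',
    Real.log_mul (pow_pos hμ _).ne' hTT1.det_pos.ne', Real.log_pow, Real.log_pow]
  push_cast
  ring

/-- Applying the first M columns to x is applying T to x padded with zeros. -/
lemma mulVec_submatrix_castAdd_injective {T : Matrix (Fin (M + K)) (Fin (M + K)) ℝ}
    (hT : IsUnit T) : Function.Injective (T.submatrix id (Fin.castAdd K)).mulVec := by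
  intro x y hxy
  have hinj := Matrix.mulVec_injective_of_isUnit hT
  have h : ∀ x : Fin M → ℝ, T *ᵥ (Fin.append x 0) = T.submatrix id (Fin.castAdd K) *ᵥ x := by
    intro x
    ext i
    simp [Matrix.mulVec, dotProduct, Fin.sum_univ_add]
  have h2 := hinj ((h x).trans (hxy.trans (h y).symm))
  ext i
  simpa using congrFun h2 (Fin.castAdd K i)

lemma posDef_transpose_mul_mul_submatrix {C T : Matrix (Fin (M + K)) (Fin (M + K)) ℝ}
    (hC : C.PosDef) (hT : IsUnit T) :
    ((T.submatrix id (Fin.castAdd K))ᵀ * C * T.submatrix id (Fin.castAdd K)).PosDef := by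
  have h := hC.conjTranspose_mul_mul_same (mulVec_submatrix_castAdd_injective hT)
  rwa [Matrix.conjTranspose_eq_transpose_of_trivial] at h

end Determinants

end RelevantLoss

end

/-! ### Evaluation and optimality of the bound in the eigenbasis -/

theorem mainTheorem3 {Ω : Type*} [MeasurableSpace Ω] (P : Measure Ω) [IsProbabilityMeasure P]
    (M K : ℕ) (S N X : Ω → EuclideanSpace ℝ (Fin (M + K)))
    (hS : Measurable S) (hN : Measurable N) (hX : ∀ ω, X ω = S ω + N ω)
    (hS2 : MemLp S 2 P) (hN2 : MemLp N 2 P)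
    (hNac : P.map N ≪ volume)
    (hSN : IndepFun S N P)
    (μ : ℝ) (hμ : 0 < μ) (hCN : RelevantLoss.covMatrix (P.map N) = μ • 1)
    (W : Matrix (Fin (M + K)) (Fin (M + K)) ℝ) (hW : W ∈ Matrix.orthogonalGroup (Fin (M + K)) ℝ)
    (lam : Fin (M + K) → ℝ) (hlam : Antitone lam)
    (hPCA : Wᵀ * RelevantLoss.covMatrix (P.map X) * W = Matrix.diagonal lam)
    (hJ : RelevantLoss.MoreGaussian M K P X N W) :
    (RelevantLoss.relevantLoss P S X
        (fun ω => RelevantLoss.firstPart M K (RelevantLoss.transform W (X ω))) : EReal)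
      ≤ (RelevantLoss.gaussianBound M K P X N W : EReal) ∧
    RelevantLoss.gaussianBound M K P X N W
      = 1 / 2 * Real.log (∏ i : Fin K, lam (Fin.natAdd M i) / μ) ∧
    ∀ T : Matrix (Fin (M + K)) (Fin (M + K)) ℝ, IsUnit T →
      RelevantLoss.gaussianBound M K P X N W ≤ RelevantLoss.gaussianBound M K P X N T ∧
      (RelevantLoss.MoreGaussian M K P X N T →
        (RelevantLoss.relevantLoss P S X
            (fun ω => RelevantLoss.firstPart M K (RelevantLoss.transform T (X ω))) : EReal)
          ≤ (RelevantLoss.gaussianBound M K P X N T : EReal)) := by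
  have hW1 : Wᵀ * W = 1 := (Matrix.mem_orthogonalGroup_iff' _ _).1 hW
  have hW2 : W * Wᵀ = 1 := (Matrix.mem_orthogonalGroup_iff _ _).1 hW
  have hWu : IsUnit W := ⟨⟨W, Wᵀ, hW2, hW1⟩, rfl⟩
  have hXm : Measurable X := by rw [funext hX]; exact hS.add hN
  have hX2 : MemLp X 2 P := by rw [funext hX]; exact hS2.add hN2
  have hp : IsProbabilityMeasure (P.map S) := Measure.isProbabilityMeasure_map hS.aemeasurable
  have hone : (1 : Matrix (Fin (M + K)) (Fin (M + K)) ℝ).PosDef := Matrix.PosDef.one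
  have hNpos : (RelevantLoss.covMatrix (P.map N)).PosDef := by rw [hCN]; exact hone.smul hμ
  -- By independence Cov(X) = Cov(S) + μI, which is positive definite even if S is degenerate.
  have hXpos : (RelevantLoss.covMatrix (P.map X)).PosDef := by
    rw [funext hX, RelevantLoss.covMatrix_map_add hS2 hN2 hS hN hSN]
    exact Matrix.PosDef.posSemidef_add (RelevantLoss.covMatrix_posSemidef
      (RelevantLoss.memLp_id_map hS2 hS.aemeasurable)) hNpos
  set C := RelevantLoss.covMatrix (P.map X) with hC
  have hlampos : ∀ i, 0 < lam i := by
    have h := RelevantLoss.posDef_transpose_mul_mul hXpos hWu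
    rw [hPCA] at h
    exact Matrix.posDef_diagonal_iff.1 h
  have hloss : ∀ T : Matrix (Fin (M + K)) (Fin (M + K)) ℝ, IsUnit T →
      RelevantLoss.MoreGaussian M K P X N T →
      (RelevantLoss.relevantLoss P S X
        (fun ω => RelevantLoss.firstPart M K (RelevantLoss.transform T (X ω))) : EReal)
        ≤ (RelevantLoss.gaussianBound M K P X N T : EReal) := by
    intro T hT hJT
    refine RelevantLoss.relevantLoss_le_gaussianBound hS hN hX hX2 hN2 hNac hSN hT ?_ ?_ hJT
    · rw [RelevantLoss.covMatrix_map_transform hX2 hXm]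
      exact RelevantLoss.posDef_transpose_mul_mul hXpos hT
    · rw [RelevantLoss.covMatrix_map_transform hN2 hN]
      exact RelevantLoss.posDef_transpose_mul_mul hNpos hT
  have hCeq : C = W * Matrix.diagonal lam * Wᵀ := by
    rw [← hPCA]
    simp only [Matrix.mul_assoc, hW2, Matrix.mul_one]
    rw [← Matrix.mul_assoc, hW2, Matrix.one_mul]
  have hdet : C.det = (∏ i, lam (Fin.castAdd K i)) * ∏ i, lam (Fin.natAdd M i) := by
    have h := congrArg Matrix.det hPCA
    rw [Matrix.det_mul, Matrix.det_mul, mul_right_comm, ← Matrix.det_mul, hW1, Matrix.det_one,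
      one_mul, Matrix.det_diagonal, Fin.prod_univ_add] at h
    exact h
  have hpM : 0 < ∏ i, lam (Fin.castAdd K i) := Finset.prod_pos fun i _ => hlampos _
  have hpK : 0 < ∏ i, lam (Fin.natAdd M i) := Finset.prod_pos fun i _ => hlampos _
  have hBW : RelevantLoss.gaussianBound M K P X N W
      = (Real.log (∏ i, lam (Fin.natAdd M i)) - K * Real.log μ) / 2 := by
    have h1 : (W.submatrix id (Fin.castAdd K))ᵀ * W.submatrix id (Fin.castAdd K) = 1 := by
      have h := congrArg (fun A => A.submatrix (Fin.castAdd K) (Fin.castAdd K)) hW1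
      simp only [Matrix.submatrix_one _ (Fin.castAdd_injective M K)] at h
      exact h
    have h2 : (W.submatrix id (Fin.castAdd K))ᵀ * C * W.submatrix id (Fin.castAdd K)
        = Matrix.diagonal (fun i => lam (Fin.castAdd K i)) := by
      rw [← RelevantLoss.submatrix_transpose_mul_mul, hPCA,
        Matrix.submatrix_diagonal _ _ (Fin.castAdd_injective M K)]
      rfl
    rw [RelevantLoss.gaussianBound_eq hXm hN hX2 hN2 hμ hCN hXpos hWu, ← hC, h1, h2,
      Matrix.det_one, Real.log_one, Matrix.det_diagonal, hdet, Real.log_mul hpM.ne' hpK.ne']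
    ring
  refine ⟨hloss W hWu hJ, ?_, fun T hT => ⟨?_, hloss T hT⟩⟩
  · rw [hBW, Finset.prod_div_distrib, Finset.prod_const, Finset.card_univ, Fintype.card_fin,
      Real.log_div hpK.ne' (pow_pos hμ _).ne', Real.log_pow]
    ring
  · have hTT := RelevantLoss.posDef_transpose_mul_mul_submatrix hone hT
    have hTC := RelevantLoss.posDef_transpose_mul_mul_submatrix hXpos hT
    -- In the coordinates of the eigenbasis the first M columns A of T become WᵀA; this diagonalizes
    -- C and preserves AᵀA.
    have hle := RelevantLoss.det_transpose_mul_diagonal_mul_le hlam (fun i => (hlampos i).le)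
      (Wᵀ * T.submatrix id (Fin.castAdd K))
    have h1 : (Wᵀ * T.submatrix id (Fin.castAdd K))ᵀ * Matrix.diagonal lam
        * (Wᵀ * T.submatrix id (Fin.castAdd K))
        = (T.submatrix id (Fin.castAdd K))ᵀ * C * T.submatrix id (Fin.castAdd K) := by
      rw [hCeq, Matrix.transpose_mul, Matrix.transpose_transpose]
      simp only [Matrix.mul_assoc]
    have h2 : (Wᵀ * T.submatrix id (Fin.castAdd K))ᵀ * (Wᵀ * T.submatrix id (Fin.castAdd K))
        = (T.submatrix id (Fin.castAdd K))ᵀ * T.submatrix id (Fin.castAdd K) := by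
      rw [Matrix.transpose_mul, Matrix.transpose_transpose, Matrix.mul_assoc,
        ← Matrix.mul_assoc W, hW2, Matrix.one_mul]
    rw [h1, h2] at hle
    rw [Matrix.mul_one] at hTT
    have hlog := Real.log_le_log hTC.det_pos hle
    rw [Real.log_mul hpM.ne' hTT.det_pos.ne'] at hlog
    rw [hBW, RelevantLoss.gaussianBound_eq hXm hN hX2 hN2 hμ hCN hXpos hT, ← hC, hdet,
      Real.log_mul hpM.ne' hpK.ne']
    linarith
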